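/- A $3$-permutation of size $n$ is a pair $(\sigma,\tau)$ of permutations of $\{1,\dots,n\}$. It avoids $(12,12)$ if there are no $i<j$ with both $\sigma(i)<\sigma(j)$ and $\tau(i)<\tau(j)$; $Av_n((12,12))$ is the set of those that do. Write $R_\sigma(i)=\{j>i:\sigma(j)<\sigma(i)\}$, $L_\tau(i)=\{j<i:\tau(j)>\tau(i)\}$ and $$\Gamma(\sigma,\tau)=\{(|R_\sigma(i)|,|L_\tau(i)|): 1\le i\le n\}\subset\mathbb Z^2 .$$ A configuration of size $n$ is a set of $n$ points of $T_n=\{(x,y)\in\mathbb Z^2: x\ge 0,\ y\ge 0,\ x+y<n\}$. It is sparse if for all $1\le k<n$ and $a,b\in\mathbb Z$ it has at most $k$ points in $\{(x,y): x\ge a,\ y\ge b,\ x+y<a+b+k\}$. A solitaire move between finite sets $P,Q\subset\mathbb Z^2$: for some $(x,y)\in\mathbb Z^2$ and $T=\{(x,y),(x+1,y),(x,y+1)\}$, one has $|P\cap T|=|Q\cap T|=2$, and $P\,\Delta\,Q$ is a subset of $T$ of size $2$ (that is, one of two points in $T$ is moved to the third cell of $T$, the other being the pivot). The orbit of a configuration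 is the set of configurations reachable from it by a finite sequence (possibly empty) of solitaire moves. A solitaire move on $Av_n((12,12))$ from $(\sigma,\tau)$: for some $i<j$ such that $R_\sigma(i)\in\{R_\sigma(j),\,R_\sigma(j)\cup\{j\}\}$ and $L_\tau(j)\in\{L_\tau(i),\,L_\tau(i)\cup\{i\}\}$, exchange the values $\sigma(i)$ and $\sigma(j)$, or the values $\tau(i)$ and $\tau(j)$, or both, provided that the result is again in $Av_n((12,12))$. The orbit of $(\sigma,\tau)\in Av_n((12,12))$ is the set of $3$-permutations reachable from it by a finite sequence (possibly empty) of such moves. **Corollary.** For every $n$ and every solitaire orbit $O$ of $Av_n((12,12))$, there is a solitaire orbit $O'$ of configurations of size $n$, all of whose elements are sparse, such that $\Gamma$ restricts to a bijection from $O$ onto $O'$. -/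

import Mathlib

namespace TriangleSolitaire

/-- A `3`-permutation of size `n`: a pair `(σ, τ)` of permutations of `{1, …, n}`
(indexed here by `Fin n = {0, …, n - 1}`). -/
abbrev ThreePerm (n : ℕ) : Type := Equiv.Perm (Fin n) × Equiv.Perm (Fin n)

/-- `p` contains the pattern `π`: on some set of `k` indices, enumerated increasingly by `f`,
both components of `p` standardize simultaneously to those of `π`. -/
def Contains {n k : ℕ} (p : ThreePerm n) (π : ThreePerm k) : Prop :=
  ∃ f : Fin k ↪o Fin n, ∀ a b : Fin k,
    (p.1 (f a) < p.1 (f b) ↔ π.1 a < π.1 b) ∧ (p.2 (f a) < p.2 (f b) ↔ π.2 a < π.2 b)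

/-- The pattern `(12, 12)`. -/
def pattern12 : ThreePerm 2 := (1, 1)

/-- `Av_n((12, 12))`. -/
def Av (n : ℕ) : Set (ThreePerm n) := {p | ¬ Contains p pattern12}

/-- The set `R_σ(i)` of the `j > i` with `σ(j) < σ(i)` (right inversions). -/
def rightInv {n : ℕ} (σ : Equiv.Perm (Fin n)) (i : Fin n) : Finset (Fin n) :=
  Finset.univ.filter fun j => i < j ∧ σ j < σ i

/-- The set `L_σ(i)` of the `j < i` with `σ(j) > σ(i)` (left inversions). -/
def leftInv {n : ℕ} (σ : Equiv.Perm (Fin n)) (i : Fin n) : Finset (Fin n) :=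
  Finset.univ.filter fun j => j < i ∧ σ i < σ j

/-- `Γ(σ, τ)` is the set of the points `(|R_σ(i)|, |L_τ(i)|)`. -/
def Gamma {n : ℕ} (p : ThreePerm n) : Finset (ℤ × ℤ) :=
  Finset.univ.image fun i : Fin n =>
    (((rightInv p.1 i).card : ℤ), ((leftInv p.2 i).card : ℤ))

/-- A configuration of size `n`: a set of `n` points of
`T_n = {(x, y) | 0 ≤ x, 0 ≤ y, x + y < n}`. -/
def IsConfiguration (n : ℕ) (C : Finset (ℤ × ℤ)) : Prop :=
  C.card = n ∧ ∀ c ∈ C, 0 ≤ c.1 ∧ 0 ≤ c.2 ∧ c.1 + c.2 < n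

/-- A sparse configuration of size `n`: for `1 ≤ k < n`, every triangle `(a, b) + T_k`
contains at most `k` of its points. -/
def IsSparse (n : ℕ) (C : Finset (ℤ × ℤ)) : Prop :=
  IsConfiguration n C ∧ ∀ k : ℕ, 1 ≤ k → k < n → ∀ a b : ℤ,
    (C.filter fun c => a ≤ c.1 ∧ b ≤ c.2 ∧ c.1 + c.2 < a + b + k).card ≤ k

/-- The cell triple `{(x, y), (x + 1, y), (x, y + 1)}`. -/
def triple (x y : ℤ) : Finset (ℤ × ℤ) := {(x, y), (x + 1, y), (x, y + 1)}

/-- A solitaire move on the grid: of two points occupying two cells of a triple,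
one is moved to the third cell, the other one serving as pivot. -/
def GridMove (P Q : Finset (ℤ × ℤ)) : Prop :=
  ∃ x y : ℤ, (P ∩ triple x y).card = 2 ∧ (Q ∩ triple x y).card = 2 ∧
    symmDiff P Q ⊆ triple x y ∧ (symmDiff P Q).card = 2

/-- The orbit of a configuration: the configurations reachable from it by solitaire moves. -/
def gridOrbit (n : ℕ) (P : Finset (ℤ × ℤ)) : Set (Finset (ℤ × ℤ)) :=
  {Q | IsConfiguration n Q ∧ Relation.ReflTransGen GridMove P Q}

/-- A solitaire move on `Av_n((12, 12))` at `i < j`: the condition on the inversion sets holds,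
and the coordinates of `i` and `j` are exchanged along one of the three axes of the diagram,
i.e. the values of `σ`, those of `τ`, or both, are exchanged, staying in `Av_n((12, 12))`. -/
def PermMove {n : ℕ} (p q : ThreePerm n) : Prop :=
  p ∈ Av n ∧ q ∈ Av n ∧ ∃ i j : Fin n, i < j ∧
    (rightInv p.1 i = rightInv p.1 j ∨ rightInv p.1 i = rightInv p.1 j ∪ {j}) ∧
    (leftInv p.2 j = leftInv p.2 i ∨ leftInv p.2 j = leftInv p.2 i ∪ {i}) ∧
    (q = (p.1 * Equiv.swap i j, p.2) ∨
      q = (p.1, p.2 * Equiv.swap i j) ∨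
      q = (p.1 * Equiv.swap i j, p.2 * Equiv.swap i j))

/-- The orbit of a `3`-permutation under solitaire moves. -/
def permOrbit {n : ℕ} (p : ThreePerm n) : Set (ThreePerm n) :=
  {q | Relation.ReflTransGen PermMove p q}

/-- `O` is a solitaire orbit of `Av_n((12, 12))`. -/
def IsPermOrbit (n : ℕ) (O : Set (ThreePerm n)) : Prop :=
  ∃ p ∈ Av n, O = permOrbit p

/-- `O` is a solitaire orbit of sparse configurations of size `n`: the orbit of some
configuration, all of whose elements are sparse. -/
def IsSparseGridOrbit (n : ℕ) (O : Set (Finset (ℤ × ℤ))) : Prop :=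
  (∃ P, IsConfiguration n P ∧ O = gridOrbit n P) ∧ ∀ Q ∈ O, IsSparse n Q

end TriangleSolitaire

/-! Position, `τ` and `σ` are three linear orders `a`, `b`, `c`, and avoiding `(12,12)` means that
no pair is ordered alike by all three. The situation is symmetric under cyclic rotation: every other
index lies in exactly one of `inv a c i`, `inv b a i`, `inv c b i`, so their cardinalities are
barycentric coordinates of `i` with sum `n - 1`. For a set `S` and suitable extremal elements of it,
`S` and three such inversion sets are disjoint (`IsSys.card_union`). This gives sparseness. In the
case of equality, every outside index has the same relative position to all of `S`
(`IsTight.mem_cores`). For `|S| = 2` the two indices are twins, which is exactly the condition for a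
move on permutations, so moves correspond on both sides (`PermMove.gridMove`,
`GridMove.exists_permMove`). This yields the map between orbits and its surjectivity. For
injectivity, let `p` and `q` lie in one orbit with the same points, matched by `ψ`. Full triangles
that overlap or nearly touch merge into a full triangle whose three orders are determined by those
of the pieces (`Good.merge`). Along the moves from `p` to `q`, the point carrying a given position,
or a given value of `σ` or `τ`, never leaves the merged triangles around its starting cell
(`linked_of_reachable`). So each order is changed by a permutation that preserves classes and is
increasing on each class, hence by the identity. -/

namespace TriangleSolitaire

/-! ### Three linear orders: the sparseness inequality and its equality case. -/

section Orders
variable {n : ℕ}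

/-- The elements above `i` for `a` and below `i` for `b`. -/
def inv (a b : Fin n → ℕ) (i : Fin n) : Finset (Fin n) := Finset.univ.filter fun j => a i < a j ∧ b j < b i

/-- The elements above all of `S` for `a` and below all of `S` for `b`. -/
def core (a b : Fin n → ℕ) (S : Finset (Fin n)) : Finset (Fin n) :=
  Finset.univ.filter fun e => ∀ s ∈ S, a s < a e ∧ b e < b s

theorem mem_inv {a b : Fin n → ℕ} {i j : Fin n} : j ∈ inv a b i ↔ a i < a j ∧ b j < b i := by
  simp [inv]

theorem mem_core {a b : Fin n → ℕ} {S : Finset (Fin n)} {e : Fin n} :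
    e ∈ core a b S ↔ ∀ s ∈ S, a s < a e ∧ b e < b s := by
  simp [core]

/-- Three linear orders, given by injective rankings, without a pair ordered alike by all three. -/
structure IsSys (a b c : Fin n → ℕ) : Prop where
  inj_a : Function.Injective a
  inj_b : Function.Injective b
  inj_c : Function.Injective c
  avoid : ∀ i j, a i < a j → b i < b j → c i < c j → False

theorem IsSys.rot {a b c : Fin n → ℕ} (h : IsSys a b c) : IsSys b c a :=
  ⟨h.inj_b, h.inj_c, h.inj_a, fun i j h1 h2 h3 => h.avoid i j h3 h1 h2⟩

/-- `i` is the largest element of `S` for `a` or the least one for `c`. -/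
def IsExt (a c : Fin n → ℕ) (S : Finset (Fin n)) (i : Fin n) : Prop :=
  i ∈ S ∧ ((∀ s ∈ S, a s ≤ a i) ∨ ∀ s ∈ S, c i ≤ c s)

/-- A common element would lie strictly between `i` and `j` for `a`. Then `i` must be the minimum
for `c` and `j` the maximum for `b`, so all three orders put `i` below `j`. -/
theorem IsSys.inv_disjoint {a b c : Fin n → ℕ} (h : IsSys a b c) {S : Finset (Fin n)} {i j : Fin n}
    (hi : IsExt a c S i) (hj : IsExt b a S j) : Disjoint (inv a c i) (inv b a j) := by
  rw [Finset.disjoint_left]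
  intro e he he'
  rw [mem_inv] at he he'
  obtain ⟨hiS, hi⟩ := hi
  obtain ⟨hjS, hj⟩ := hj
  have hij : a i < a j := by omega
  rcases hi with hi | hi
  · have := hi j hjS
    omega
  rcases hj with hj | hj
  swap
  · have := hj i hiS
    omega
  have hne : i ≠ j := by
    rintro rfl
    omega
  exact h.avoid i j hij (lt_of_le_of_ne (hj i hiS) (h.inj_b.ne hne))
    (lt_of_le_of_ne (hi j hjS) (h.inj_c.ne hne))

theorem IsExt.disjoint {a c : Fin n → ℕ} {S : Finset (Fin n)} {i : Fin n} (hi : IsExt a c S i) :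
    Disjoint S (inv a c i) := by
  rw [Finset.disjoint_left]
  intro e he he'
  rw [mem_inv] at he'
  rcases hi.2 with hi | hi
  · have := hi e he
    omega
  · have := hi e he
    omega

theorem IsSys.card_union {a b c : Fin n → ℕ} (h : IsSys a b c) {S : Finset (Fin n)} {i j k : Fin n}
    (hi : IsExt a c S i) (hj : IsExt b a S j) (hk : IsExt c b S k) :
    (S ∪ (inv a c i ∪ (inv b a j ∪ inv c b k))).card =
      S.card + ((inv a c i).card + ((inv b a j).card + (inv c b k).card)) := by
  have h1 := h.inv_disjoint hi hj
  have h2 := h.rot.inv_disjoint hj hk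
  have h3 := h.rot.rot.inv_disjoint hk hi
  rw [Finset.card_union_of_disjoint, Finset.card_union_of_disjoint,
    Finset.card_union_of_disjoint h2]
  · exact Finset.disjoint_union_right.2 ⟨h1, h3.symm⟩
  · exact Finset.disjoint_union_right.2
      ⟨hi.disjoint, Finset.disjoint_union_right.2 ⟨hj.disjoint, hk.disjoint⟩⟩

theorem exists_isExt_left (a c : Fin n → ℕ) {S : Finset (Fin n)} (hS : S.Nonempty) :
    ∃ i, IsExt a c S i ∧ ∀ s ∈ S, a s ≤ a i := by
  obtain ⟨i, hi, h⟩ := S.exists_max_image a hS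
  exact ⟨i, ⟨hi, Or.inl h⟩, h⟩

theorem exists_isExt_right (a c : Fin n → ℕ) {S : Finset (Fin n)} (hS : S.Nonempty) :
    ∃ i, IsExt a c S i ∧ ∀ s ∈ S, c i ≤ c s := by
  obtain ⟨i, hi, h⟩ := S.exists_min_image c hS
  exact ⟨i, ⟨hi, Or.inr h⟩, h⟩

/-- The sparseness inequality. -/
theorem IsSys.card_le {a b c : Fin n → ℕ} (h : IsSys a b c) {S : Finset (Fin n)} (hS : S.Nonempty)
    {α β γ : ℤ} (hα : ∀ i ∈ S, α ≤ (inv a c i).card) (hβ : ∀ i ∈ S, β ≤ (inv b a i).card)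
    (hγ : ∀ i ∈ S, γ ≤ (inv c b i).card) : S.card + α + β + γ ≤ n := by
  obtain ⟨i, hi, -⟩ := exists_isExt_left a c hS
  obtain ⟨j, hj, -⟩ := exists_isExt_left b a hS
  obtain ⟨k, hk, -⟩ := exists_isExt_left c b hS
  have h1 := h.card_union hi hj hk
  have h2 := card_finset_fin_le (S ∪ (inv a c i ∪ (inv b a j ∪ inv c b k)))
  have := hα i hi.1
  have := hβ j hj.1
  have := hγ k hk.1
  omega

/-- Equality makes the four disjoint sets fill everything, so `inv a c i` is the complement of the
other three and does not depend on the extremal `i`. -/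
theorem IsSys.inv_eq_core {a b c : Fin n → ℕ} (h : IsSys a b c) {S : Finset (Fin n)} (hS : S.Nonempty)
    {α β γ : ℤ} (hα : ∀ i ∈ S, α ≤ (inv a c i).card) (hβ : ∀ i ∈ S, β ≤ (inv b a i).card)
    (hγ : ∀ i ∈ S, γ ≤ (inv c b i).card) (hk : S.card + α + β + γ = n) {i : Fin n}
    (hi : IsExt a c S i) : inv a c i = core a c S ∧ (inv a c i).card = α := by
  obtain ⟨j, hj, -⟩ := exists_isExt_left b a hS
  obtain ⟨k, hk, -⟩ := exists_isExt_left c b hS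
  have key : ∀ i, IsExt a c S i → (inv a c i).card = α ∧
      ∀ e, e ∈ inv a c i ↔ e ∉ S ∧ e ∉ inv b a j ∧ e ∉ inv c b k := by
    intro i hi
    have h1 := h.card_union hi hj hk
    have h2 := card_finset_fin_le (S ∪ (inv a c i ∪ (inv b a j ∪ inv c b k)))
    have := hα i hi.1
    have := hβ j hj.1
    have := hγ k hk.1
    refine ⟨by omega, fun e => ⟨fun he => ⟨?_, ?_, ?_⟩, ?_⟩⟩
    · exact Finset.disjoint_right.1 hi.disjoint he
    · exact Finset.disjoint_left.1 (h.inv_disjoint hi hj) he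
    · exact Finset.disjoint_right.1 (h.rot.rot.inv_disjoint hk hi) he
    · rintro ⟨h3, h4, h5⟩
      have h6 : S ∪ (inv a c i ∪ (inv b a j ∪ inv c b k)) = Finset.univ :=
        Finset.eq_univ_of_card _ (by rw [Fintype.card_fin]; omega)
      have h7 := Finset.mem_univ e
      rw [← h6] at h7
      simpa [h3, h4, h5] using h7
  refine ⟨?_, (key i hi).1⟩
  -- The maximum for `a` and the minimum for `c` are both admissible choices; together they bound
  -- all of `S`.
  obtain ⟨u, hu, hu'⟩ := exists_isExt_left a c hS
  obtain ⟨v, hv, hv'⟩ := exists_isExt_right a c hS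
  ext e
  rw [mem_core]
  constructor
  · intro he s hs
    have h1 := (key u hu).2 e
    have h2 := (key v hv).2 e
    rw [(key i hi).2 e] at he
    have h3 := mem_inv.1 (h1.2 he)
    have h4 := mem_inv.1 (h2.2 he)
    exact ⟨(hu' s hs).trans_lt h3.1, h4.2.trans_le (hv' s hs)⟩
  · exact fun he => mem_inv.2 (he i hi.1)

/-- `S` is a tight set for the lower bounds `α, β, γ`. -/
structure IsTight (a b c : Fin n → ℕ) (S : Finset (Fin n)) (α β γ : ℤ) : Prop where
  nonempty : S.Nonempty
  le_a : ∀ i ∈ S, α ≤ (inv a c i).card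
  le_b : ∀ i ∈ S, β ≤ (inv b a i).card
  le_c : ∀ i ∈ S, γ ≤ (inv c b i).card
  card : S.card + α + β + γ = n

theorem IsTight.rot {a b c : Fin n → ℕ} {S : Finset (Fin n)} {α β γ : ℤ} (h : IsTight a b c S α β γ) :
    IsTight b c a S β γ α :=
  ⟨h.nonempty, h.le_b, h.le_c, h.le_a, by have := h.card; omega⟩

theorem IsTight.card_core {a b c : Fin n → ℕ} (h : IsSys a b c) {S : Finset (Fin n)} {α β γ : ℤ}
    (hS : IsTight a b c S α β γ) : (core a c S).card = α := by
  obtain ⟨i, hi, -⟩ := exists_isExt_left a c hS.nonempty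
  have := h.inv_eq_core hS.nonempty hS.le_a hS.le_b hS.le_c hS.card hi
  rw [← this.1, this.2]

/-- The structural form of tightness: an outside element cannot distinguish the elements of `S`. -/
theorem IsTight.mem_cores {a b c : Fin n → ℕ} (h : IsSys a b c) {S : Finset (Fin n)} {α β γ : ℤ}
    (hS : IsTight a b c S α β γ) {e : Fin n} (he : e ∉ S) :
    e ∈ core a c S ∨ e ∈ core b a S ∨ e ∈ core c b S := by
  obtain ⟨i, hi, -⟩ := exists_isExt_left a c hS.nonempty
  obtain ⟨j, hj, -⟩ := exists_isExt_left b a hS.nonempty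
  obtain ⟨k, hk, -⟩ := exists_isExt_left c b hS.nonempty
  have h1 := h.inv_eq_core hS.nonempty hS.le_a hS.le_b hS.le_c hS.card hi
  have hS' := hS.rot
  have h2 := h.rot.inv_eq_core hS'.nonempty hS'.le_a hS'.le_b hS'.le_c hS'.card hj
  have hS'' := hS'.rot
  have h3 := h.rot.rot.inv_eq_core hS''.nonempty hS''.le_a hS''.le_b hS''.le_c hS''.card hk
  rw [← h1.1, ← h2.1, ← h3.1]
  have h4 := h.card_union hi hj hk
  have h6 : S ∪ (inv a c i ∪ (inv b a j ∪ inv c b k)) = Finset.univ :=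
    Finset.eq_univ_of_card _ (by have := hS.card; rw [Fintype.card_fin]; omega)
  have h7 := Finset.mem_univ e
  rw [← h6] at h7
  simpa [he] using h7

end Orders

/-! ### Merging full triangles. -/

section Merging
variable {n : ℕ}

/-- The core shrinks as the set grows, but the common bound `α` fixes its size. -/
theorem IsTight.core_eq {a b c : Fin n → ℕ} (h : IsSys a b c) {S T : Finset (Fin n)}
    {α β γ β' γ' : ℤ} (hS : IsTight a b c S α β γ) (hT : IsTight a b c T α β' γ')
    (hST : S ⊆ T) : core a c S = core a c T := by
  refine (Finset.eq_of_subset_of_card_le (fun e he => ?_) ?_).symm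
  · rw [mem_core] at he ⊢
    exact fun s hs => he s (hST hs)
  · have := hS.card_core h
    have := hT.card_core h
    omega

/-- `S₁` shares two bounds with `S`, hence two cores, so `j` can only lie in the third core of `S₁`;
this settles `b` and `c`. For `a`, an element outside `S₂` lies above or below all of `S₂`, and
exactly `α₂ - α₁` elements of `S` lie in the upper core. Its rank within `S₁` therefore decides, and
that rank is visible in the order on `S₁` alone. -/
theorem IsTight.order_of_corner {a b c : Fin n → ℕ} (h : IsSys a b c)
    {S S₁ S₂ : Finset (Fin n)} {α₁ β₁ γ₁ α₂ β₂ γ₂ : ℤ} (h₁ : IsTight a b c S₁ α₁ β₁ γ₁)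
    (h₂ : IsTight a b c S₂ α₂ β₂ γ₂) (hS : IsTight a b c S α₁ β₁ γ₂) (hu : S = S₁ ∪ S₂)
    {i j : Fin n} (hi : i ∈ S₁) (hj : j ∈ S) (hj' : j ∉ S₁) :
    c i < c j ∧ b j < b i ∧ (i ∉ S₂ →
      (a j < a i ↔ ((S₁.filter fun l => a i < a l).card : ℤ) < α₂ - α₁)) := by
  have hs₁ : S₁ ⊆ S := hu ▸ Finset.subset_union_left
  have hs₂ : S₂ ⊆ S := hu ▸ Finset.subset_union_right
  have hj₂ : j ∈ S₂ := by
    rw [hu, Finset.mem_union] at hj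
    tauto
  have hA : core a c S₁ = core a c S := h₁.core_eq h hS hs₁
  have hB : core b a S₁ = core b a S := h₁.rot.core_eq h.rot hS.rot hs₁
  have hC : core c b S₂ = core c b S := h₂.rot.rot.core_eq h.rot.rot hS.rot.rot hs₂
  have hjC : j ∈ core c b S₁ := by
    rcases h₁.mem_cores h hj' with h' | h' | h'
    · rw [hA, mem_core] at h'
      exact absurd (h' j hj).1 (lt_irrefl _)
    · rw [hB, mem_core] at h'
      exact absurd (h' j hj).1 (lt_irrefl _)
    · exact h'
  refine ⟨(mem_core.1 hjC i hi).1, (mem_core.1 hjC i hi).2, fun hi₂ => ?_⟩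
  have hsub : core a c S ⊆ core a c S₂ := fun e he =>
    mem_core.2 fun s hs => mem_core.1 he s (hs₂ hs)
  have hcard : ((core a c S₂ \ core a c S).card : ℤ) = α₂ - α₁ := by
    rw [Finset.card_sdiff_of_subset hsub, Nat.cast_sub (Finset.card_le_card hsub),
      h₂.card_core h, hS.card_core h]
  have hnot : ∀ l ∈ S, l ∉ core a c S := fun l hl hl' =>
    absurd (mem_core.1 hl' l hl).1 (lt_irrefl _)
  have hcases : ∀ l ∈ S, l ∉ S₂ → l ∈ core a c S₂ ∨ l ∈ core b a S₂ := by
    intro l hl hl₂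
    rcases h₂.mem_cores h hl₂ with h' | h' | h'
    · exact Or.inl h'
    · exact Or.inr h'
    · rw [hC, mem_core] at h'
      exact absurd (h' l hl).1 (lt_irrefl _)
  rw [← hcard, Nat.cast_lt]
  rcases hcases i (hs₁ hi) hi₂ with hi' | hi'
  · have hji := (mem_core.1 hi' j hj₂).1
    refine ⟨fun _ => Finset.card_lt_card ?_, fun _ => hji⟩
    rw [Finset.ssubset_iff_of_subset]
    · exact ⟨i, Finset.mem_sdiff.2 ⟨hi', hnot i (hs₁ hi)⟩, by simp⟩
    · intro l hl
      rw [Finset.mem_filter] at hl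
      refine Finset.mem_sdiff.2 ⟨?_, hnot l (hs₁ hl.1)⟩
      have hl₂ : l ∉ S₂ := fun hl₂ => by
        have := (mem_core.1 hi' l hl₂).1
        omega
      refine (hcases l (hs₁ hl.1) hl₂).resolve_right fun hl' => ?_
      have := (mem_core.1 hl' j hj₂).2
      omega
  · have hij := (mem_core.1 hi' j hj₂).2
    refine ⟨fun _ => by omega, fun hlt => absurd hlt (not_lt.2 (Finset.card_le_card ?_))⟩
    intro l hl
    rw [Finset.mem_sdiff] at hl
    have hl' := (mem_core.1 hl.1 j hj₂).1
    refine Finset.mem_filter.2 ⟨?_, by omega⟩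
    have hlS : l ∈ S := by
      by_contra hlS
      rcases hS.mem_cores h hlS with h' | h' | h'
      · exact hl.2 h'
      · have := (mem_core.1 h' j hj).2
        omega
      · have h1 := (mem_core.1 h' j hj).1
        have h2 := (mem_core.1 hl.1 j hj₂).2
        omega
    rw [hu, Finset.mem_union] at hlS
    refine hlS.resolve_right fun hl₂ => ?_
    exact absurd (mem_core.1 hl.1 l hl₂).1 (lt_irrefl _)

/-- The indices whose point satisfies the lower bounds `α, β, γ`. -/
def region (a b c : Fin n → ℕ) (α β γ : ℤ) : Finset (Fin n) :=
  Finset.univ.filter fun i =>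
    α ≤ (inv a c i).card ∧ β ≤ (inv b a i).card ∧ γ ≤ (inv c b i).card

theorem mem_region {a b c : Fin n → ℕ} {α β γ : ℤ} {i : Fin n} :
    i ∈ region a b c α β γ ↔
      α ≤ (inv a c i).card ∧ β ≤ (inv b a i).card ∧ γ ≤ (inv c b i).card := by
  simp [region]

theorem region_rot (a b c : Fin n → ℕ) (α β γ : ℤ) :
    region b c a β γ α = region a b c α β γ := by
  ext i
  simp only [mem_region]
  tauto

theorem isTight_region {a b c : Fin n → ℕ} {α β γ : ℤ} (h : (region a b c α β γ).Nonempty)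
    (h' : (region a b c α β γ).card + α + β + γ = n) :
    IsTight a b c (region a b c α β γ) α β γ :=
  ⟨h, fun _ hi => (mem_region.1 hi).1, fun _ hi => (mem_region.1 hi).2.1,
    fun _ hi => (mem_region.1 hi).2.2, h'⟩

theorem IsSys.card_region_le {a b c : Fin n → ℕ} (h : IsSys a b c) {α β γ : ℤ}
    (hS : (region a b c α β γ).Nonempty) : (region a b c α β γ).card + α + β + γ ≤ n :=
  h.card_le hS (fun _ hi => (mem_region.1 hi).1) (fun _ hi => (mem_region.1 hi).2.1)
    fun _ hi => (mem_region.1 hi).2.2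

/-- `f` and `g` order the elements of `S` alike. -/
def SameOrder (f g : Fin n → ℕ) (S : Finset (Fin n)) : Prop :=
  ∀ i ∈ S, ∀ j ∈ S, f i < f j ↔ g i < g j

/-- Two systems with the same points. -/
structure IsPair (a b c a' b' c' : Fin n → ℕ) : Prop where
  left : IsSys a b c
  right : IsSys a' b' c'
  card_a : ∀ i, (inv a' c' i).card = (inv a c i).card
  card_b : ∀ i, (inv b' a' i).card = (inv b a i).card
  card_c : ∀ i, (inv c' b' i).card = (inv c b i).card

theorem IsPair.rot {a b c a' b' c' : Fin n → ℕ} (h : IsPair a b c a' b' c') :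
    IsPair b c a b' c' a' :=
  ⟨h.left.rot, h.right.rot, h.card_b, h.card_c, h.card_a⟩

theorem IsPair.region_eq {a b c a' b' c' : Fin n → ℕ} (h : IsPair a b c a' b' c') (α β γ : ℤ) :
    region a' b' c' α β γ = region a b c α β γ := by
  ext i
  simp only [mem_region, h.card_a, h.card_b, h.card_c]

/-- The triangle given by the lower bounds `α, β, γ` is full, and both systems induce the same
orders on it. -/
structure Good (a b c a' b' c' : Fin n → ℕ) (α β γ : ℤ) : Prop where
  nonempty : (region a b c α β γ).Nonempty
  card : (region a b c α β γ).card + α + β + γ = n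
  same_a : SameOrder a a' (region a b c α β γ)
  same_b : SameOrder b b' (region a b c α β γ)
  same_c : SameOrder c c' (region a b c α β γ)

theorem Good.rot {a b c a' b' c' : Fin n → ℕ} {α β γ : ℤ} (h : Good a b c a' b' c' α β γ) :
    Good b c a b' c' a' β γ α := by
  have hr := region_rot a b c α β γ
  refine ⟨hr ▸ h.nonempty, ?_, hr ▸ h.same_b, hr ▸ h.same_c, hr ▸ h.same_a⟩
  have := h.card
  rw [hr]
  omega

theorem SameOrder.union {f g : Fin n → ℕ} (hf : f.Injective) (hg : g.Injective)
    {S₁ S₂ : Finset (Fin n)} (h₁ : SameOrder f g S₁) (h₂ : SameOrder f g S₂)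
    (h : ∀ i ∈ S₁, ∀ j ∈ S₂, i ∉ S₂ → j ∉ S₁ → (f j < f i ↔ g j < g i)) :
    SameOrder f g (S₁ ∪ S₂) := by
  have key : ∀ i ∈ S₁, ∀ j ∈ S₂, (f j < f i ↔ g j < g i) ∧ (f i < f j ↔ g i < g j) := by
    intro i hi j hj
    by_cases hi' : i ∈ S₂
    · exact ⟨h₂ j hj i hi', h₂ i hi' j hj⟩
    by_cases hj' : j ∈ S₁
    · exact ⟨h₁ j hj' i hi, h₁ i hi j hj'⟩
    have hne : i ≠ j := fun e => hj' (e ▸ hi)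
    have h1 := h i hi j hj hi' hj'
    have h2 := hf.ne hne
    have h3 := hg.ne hne
    omega
  intro i hi j hj
  rw [Finset.mem_union] at hi hj
  rcases hi with hi | hi <;> rcases hj with hj | hj
  · exact h₁ i hi j hj
  · exact (key i hi j hj).2
  · exact (key j hj i hi).1
  · exact h₂ i hi j hj

/-- Inclusion-exclusion: the two full triangles have union at least as large as the enclosing
triangle allows, since their intersection obeys the sparseness bound. So the union is the whole
enclosing triangle, and `IsTight.order_of_corner` applies in both systems. -/
theorem Good.merge_corner {a b c a' b' c' : Fin n → ℕ} (h : IsPair a b c a' b' c')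
    {α₁ β₁ γ₁ α₂ β₂ γ₂ : ℤ} (h₁ : Good a b c a' b' c' α₁ β₁ γ₁)
    (h₂ : Good a b c a' b' c' α₂ β₂ γ₂) (hα : α₁ ≤ α₂) (hβ : β₁ ≤ β₂)
    (hmax : α₂ + β₂ + max γ₁ γ₂ ≤ n) : Good a b c a' b' c' α₁ β₁ (min γ₁ γ₂) := by
  rcases le_total γ₁ γ₂ with hγ | hγ
  · rwa [min_eq_left hγ]
  rw [min_eq_right hγ]
  rw [max_eq_left hγ] at hmax
  have hs₁ : region a b c α₁ β₁ γ₁ ⊆ region a b c α₁ β₁ γ₂ := fun i hi => by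
    rw [mem_region] at hi ⊢
    omega
  have hs₂ : region a b c α₂ β₂ γ₂ ⊆ region a b c α₁ β₁ γ₂ := fun i hi => by
    rw [mem_region] at hi ⊢
    omega
  have hinter : region a b c α₁ β₁ γ₁ ∩ region a b c α₂ β₂ γ₂ = region a b c α₂ β₂ γ₁ := by
    ext i
    rw [Finset.mem_inter, mem_region, mem_region, mem_region]
    omega
  have hne : (region a b c α₁ β₁ γ₂).Nonempty := h₁.nonempty.mono hs₁
  have hle := h.left.card_region_le hne
  -- An empty intersection is allowed as long as its formal size is not negative; only this case
  -- needs `hmax`.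
  have hle' : (region a b c α₂ β₂ γ₁).card + α₂ + β₂ + γ₁ ≤ n := by
    rcases (region a b c α₂ β₂ γ₁).eq_empty_or_nonempty with h0 | h0
    · rw [h0, Finset.card_empty]
      omega
    · exact h.left.card_region_le h0
  have hsum := Finset.card_union_add_card_inter (region a b c α₁ β₁ γ₁) (region a b c α₂ β₂ γ₂)
  rw [hinter] at hsum
  have hsub := Finset.union_subset hs₁ hs₂
  have hc := Finset.card_le_card hsub
  have hc₁ := h₁.card
  have hc₂ := h₂.card
  have hu : region a b c α₁ β₁ γ₂ = region a b c α₁ β₁ γ₁ ∪ region a b c α₂ β₂ γ₂ :=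
    (Finset.eq_of_subset_of_card_le hsub (by omega)).symm
  have hcard : (region a b c α₁ β₁ γ₂).card + α₁ + β₁ + γ₂ = n := by omega
  have hT := isTight_region hne hcard
  have hT₁ := isTight_region h₁.nonempty h₁.card
  have hT₂ := isTight_region h₂.nonempty h₂.card
  have hT' : IsTight a' b' c' (region a b c α₁ β₁ γ₂) α₁ β₁ γ₂ := by
    rw [← h.region_eq]
    exact isTight_region (by rwa [h.region_eq]) (by rwa [h.region_eq])
  have hT₁' : IsTight a' b' c' (region a b c α₁ β₁ γ₁) α₁ β₁ γ₁ := by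
    rw [← h.region_eq]
    exact isTight_region (by rw [h.region_eq]; exact h₁.nonempty)
      (by rw [h.region_eq]; exact h₁.card)
  have hT₂' : IsTight a' b' c' (region a b c α₂ β₂ γ₂) α₂ β₂ γ₂ := by
    rw [← h.region_eq]
    exact isTight_region (by rw [h.region_eq]; exact h₂.nonempty)
      (by rw [h.region_eq]; exact h₂.card)
  have key := fun i (hi : i ∈ region a b c α₁ β₁ γ₁) j (hj : j ∈ region a b c α₂ β₂ γ₂)
      (hj' : j ∉ region a b c α₁ β₁ γ₁) => And.intro
    (hT₁.order_of_corner h.left hT₂ hT hu hi (hs₂ hj) hj')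
    (hT₁'.order_of_corner h.right hT₂' hT' hu hi (hs₂ hj) hj')
  refine ⟨hne, hcard, ?_, ?_, ?_⟩ <;> rw [hu]
  · refine SameOrder.union h.left.inj_a h.right.inj_a h₁.same_a h₂.same_a ?_
    intro i hi j hj hi' hj'
    rw [(key i hi j hj hj').1.2.2 hi', (key i hi j hj hj').2.2.2 hi']
    have : (region a b c α₁ β₁ γ₁).filter (fun l => a i < a l) =
        (region a b c α₁ β₁ γ₁).filter fun l => a' i < a' l :=
      Finset.filter_congr fun l hl => h₁.same_a i hi l hl
    rw [this]
  · refine SameOrder.union h.left.inj_b h.right.inj_b h₁.same_b h₂.same_b ?_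
    intro i hi j hj hi' hj'
    exact iff_of_true (key i hi j hj hj').1.2.1 (key i hi j hj hj').2.2.1
  · refine SameOrder.union h.left.inj_c h.right.inj_c h₁.same_c h₂.same_c ?_
    intro i hi j hj hi' hj'
    have h1 := (key i hi j hj hj').1.1
    have h2 := (key i hi j hj hj').2.1
    omega

/-- One of the two triangles attains at least two of the three minima; rotation reduces to the
corner case. -/
theorem Good.merge {a b c a' b' c' : Fin n → ℕ} (h : IsPair a b c a' b' c')
    {α₁ β₁ γ₁ α₂ β₂ γ₂ : ℤ} (h₁ : Good a b c a' b' c' α₁ β₁ γ₁)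
    (h₂ : Good a b c a' b' c' α₂ β₂ γ₂) (hmax : max α₁ α₂ + max β₁ β₂ + max γ₁ γ₂ ≤ n) :
    Good a b c a' b' c' (min α₁ α₂) (min β₁ β₂) (min γ₁ γ₂) := by
  rcases le_total α₁ α₂ with hα | hα <;> rcases le_total β₁ β₂ with hβ | hβ
  · rw [min_eq_left hα, min_eq_left hβ]
    exact h₁.merge_corner h h₂ hα hβ (by omega)
  · rcases le_total γ₁ γ₂ with hγ | hγ
    · rw [min_eq_left hα, min_eq_left hγ]
      exact (h₁.rot.rot.merge_corner h.rot.rot h₂.rot.rot hγ hα (by omega)).rot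
    · rw [min_eq_right hβ, min_eq_right hγ, min_comm]
      exact (h₂.rot.merge_corner h.rot h₁.rot hβ hγ (by omega)).rot.rot
  · rcases le_total γ₁ γ₂ with hγ | hγ
    · rw [min_eq_left hβ, min_eq_left hγ]
      exact (h₁.rot.merge_corner h.rot h₂.rot hβ hγ (by omega)).rot.rot
    · rw [min_eq_right hα, min_eq_right hγ, min_comm]
      exact (h₂.rot.rot.merge_corner h.rot.rot h₁.rot.rot hγ hα (by omega)).rot
  · rw [min_eq_right hα, min_eq_right hβ, min_comm]
    exact h₂.merge_corner h h₁ hα hβ (by omega)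

end Merging

/-! ### Points of a permutation pair, and twins. -/

section Moves
variable {n : ℕ}

theorem mem_Av {p : ThreePerm n} :
    p ∈ Av n ↔ ∀ i j, i < j → p.1 i < p.1 j → p.2 i < p.2 j → False := by
  constructor
  · intro h i j hij h1 h2
    have hm : StrictMono ![i, j] := by
      intro a b hab
      fin_cases a <;> fin_cases b <;> simp_all
    refine h ⟨OrderEmbedding.ofStrictMono _ hm, fun a b => ?_⟩
    change (p.1 (![i, j] a) < p.1 (![i, j] b) ↔ _) ∧ (p.2 (![i, j] a) < p.2 (![i, j] b) ↔ _)
    fin_cases a <;> fin_cases b <;> simp [pattern12, h1, h2, h1.le, h2.le]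
  · rintro h ⟨f, hf⟩
    have h1 := hf 0 1
    simp only [pattern12, Equiv.Perm.coe_one, id_eq, Fin.zero_lt_one, iff_true] at h1
    exact h _ _ (f.strictMono Fin.zero_lt_one) h1.1 h1.2

/-- The ranking by position. -/
def posRank (i : Fin n) : ℕ := i

/-- The ranking by value. -/
def permRank (σ : Equiv.Perm (Fin n)) (i : Fin n) : ℕ := σ i

theorem isSys_of_mem_Av {p : ThreePerm n} (hp : p ∈ Av n) :
    IsSys posRank (permRank p.2) (permRank p.1) :=
  ⟨fun _ _ h => Fin.ext h, fun _ _ h => p.2.injective (Fin.ext h),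
    fun _ _ h => p.1.injective (Fin.ext h), fun i j h1 h2 h3 => mem_Av.1 hp i j h1 h3 h2⟩

theorem mem_rightInv {σ : Equiv.Perm (Fin n)} {i j : Fin n} :
    j ∈ rightInv σ i ↔ i < j ∧ σ j < σ i := by
  simp [rightInv]

theorem mem_leftInv {σ : Equiv.Perm (Fin n)} {i j : Fin n} :
    j ∈ leftInv σ i ↔ j < i ∧ σ i < σ j := by
  simp [leftInv]

theorem rightInv_eq_inv (σ : Equiv.Perm (Fin n)) (i : Fin n) :
    rightInv σ i = inv posRank (permRank σ) i := rfl

theorem leftInv_eq_inv (σ : Equiv.Perm (Fin n)) (i : Fin n) :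
    leftInv σ i = inv (permRank σ) posRank i := by
  ext j
  rw [mem_leftInv, mem_inv, and_comm]
  rfl

/-- The point of the index `i`. -/
def point (p : ThreePerm n) (i : Fin n) : ℤ × ℤ :=
  (((rightInv p.1 i).card : ℤ), ((leftInv p.2 i).card : ℤ))

theorem Gamma_eq (p : ThreePerm n) : Gamma p = Finset.univ.image (point p) := rfl

theorem mem_Gamma {p : ThreePerm n} {c : ℤ × ℤ} : c ∈ Gamma p ↔ ∃ i, point p i = c := by
  simp [Gamma_eq]

theorem IsSys.card_inv_add {a b c : Fin n → ℕ} (h : IsSys a b c) (i : Fin n) :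
    (inv a c i).card + (inv b a i).card + (inv c b i).card + 1 = n := by
  have h1 : ∀ f g : Fin n → ℕ, IsExt f g {i} i := fun f g => by simp [IsExt]
  have h2 := h.card_union (h1 a c) (h1 b a) (h1 c b)
  have h3 : ({i} ∪ (inv a c i ∪ (inv b a i ∪ inv c b i)) : Finset (Fin n)) = Finset.univ := by
    rw [Finset.eq_univ_iff_forall]
    intro e
    by_cases he : e = i
    · simp [he]
    have ha := h.inj_a.ne he
    have hb := h.inj_b.ne he
    have hc := h.inj_c.ne he
    have h4 : ¬ (a e < a i ∧ b e < b i ∧ c e < c i) := fun h' => h.avoid e i h'.1 h'.2.1 h'.2.2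
    have h5 : ¬ (a i < a e ∧ b i < b e ∧ c i < c e) := fun h' => h.avoid i e h'.1 h'.2.1 h'.2.2
    simp only [Finset.mem_union, mem_inv, Finset.mem_singleton]
    by_contra hcon
    omega
  rw [h3, Finset.card_univ, Fintype.card_fin, Finset.card_singleton] at h2
  omega

/-- The third coordinate is `n - 1 - x - y`, so a lower bound `γ` on it reads `x + y < n - γ`. -/
theorem card_filter_point {p : ThreePerm n} (hp : p ∈ Av n) (α β γ : ℤ) :
    (Finset.univ.filter fun i => α ≤ (point p i).1 ∧ β ≤ (point p i).2 ∧
      (point p i).1 + (point p i).2 < n - γ) =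
      region posRank (permRank p.2) (permRank p.1) α β γ := by
  ext i
  have h1 := (isSys_of_mem_Av hp).card_inv_add i
  rw [mem_region, Finset.mem_filter, point, rightInv_eq_inv, leftInv_eq_inv]
  simp only [Finset.mem_univ, true_and]
  refine and_congr_right fun _ => and_congr_right fun _ => ?_
  omega

theorem card_points_le {p : ThreePerm n} (hp : p ∈ Av n) (a b : ℤ) (k : ℕ) {S : Finset (Fin n)}
    (hS : ∀ i ∈ S, a ≤ (point p i).1 ∧ b ≤ (point p i).2 ∧
      (point p i).1 + (point p i).2 < a + b + k) : S.card ≤ k := by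
  rcases S.eq_empty_or_nonempty with rfl | hne
  · simp
  have hsub : S ⊆ region posRank (permRank p.2) (permRank p.1) a b (n - a - b - k) := by
    intro i hi
    rw [← card_filter_point hp, Finset.mem_filter]
    obtain ⟨h1, h2, h3⟩ := hS i hi
    exact ⟨Finset.mem_univ _, h1, h2, by omega⟩
  have h1 := (isSys_of_mem_Av hp).card_region_le (hne.mono hsub)
  have h2 := Finset.card_le_card hsub
  omega

theorem point_injective {p : ThreePerm n} (hp : p ∈ Av n) : (point p).Injective := by
  intro i j hij
  by_contra hne
  have := card_points_le hp (point p i).1 (point p i).2 1 (S := {i, j}) (by simp [← hij])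
  rw [Finset.card_pair hne] at this
  omega

theorem isSparse_Gamma {p : ThreePerm n} (hp : p ∈ Av n) : IsSparse n (Gamma p) := by
  refine ⟨⟨?_, ?_⟩, ?_⟩
  · rw [Gamma_eq, Finset.card_image_of_injective _ (point_injective hp), Finset.card_univ,
      Fintype.card_fin]
  · intro c hc
    obtain ⟨i, rfl⟩ := mem_Gamma.1 hc
    have h1 := (isSys_of_mem_Av hp).card_inv_add i
    rw [point, rightInv_eq_inv, leftInv_eq_inv]
    simp only
    omega
  · intro k _ _ a b
    rw [Gamma_eq, Finset.filter_image]
    refine Finset.card_image_le.trans (card_points_le hp a b k fun i hi => ?_)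
    exact (Finset.mem_filter.1 hi).2

/-- Every index other than `i, j` has the same relative position to both of them. -/
def IsTwin (p : ThreePerm n) (i j : Fin n) : Prop :=
  ∀ e, e ≠ i → e ≠ j →
    (i < e ∧ j < e ∧ p.1 e < p.1 i ∧ p.1 e < p.1 j) ∨
    (e < i ∧ e < j ∧ p.2 i < p.2 e ∧ p.2 j < p.2 e) ∨
    (p.1 i < p.1 e ∧ p.1 j < p.1 e ∧ p.2 e < p.2 i ∧ p.2 e < p.2 j)

/-- The hypotheses match two of the three relative positions of `e` to `i` and to `j`; avoidance
forces the third when both fail. -/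
theorem isTwin_of_inv {p : ThreePerm n} (hp : p ∈ Av n) {i j : Fin n}
    (hR : rightInv p.1 i = rightInv p.1 j ∨ rightInv p.1 i = rightInv p.1 j ∪ {j})
    (hL : leftInv p.2 j = leftInv p.2 i ∨ leftInv p.2 j = leftInv p.2 i ∪ {i}) :
    IsTwin p i j := by
  intro e hi hj
  have hR' : e ∈ rightInv p.1 i ↔ e ∈ rightInv p.1 j := by
    rcases hR with h | h <;> simp [h, hj]
  have hL' : e ∈ leftInv p.2 j ↔ e ∈ leftInv p.2 i := by
    rcases hL with h | h <;> simp [h, hi]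
  rw [mem_rightInv, mem_rightInv] at hR'
  rw [mem_leftInv, mem_leftInv] at hL'
  have key : ∀ f, e ≠ f → ¬ (f < e ∧ p.1 e < p.1 f) → ¬ (e < f ∧ p.2 f < p.2 e) →
      p.1 f < p.1 e ∧ p.2 e < p.2 f := by
    intro f hf h1 h2
    have h3 := p.1.injective.ne hf
    have h4 := p.2.injective.ne hf
    have h5 : ¬ (e < f ∧ p.1 e < p.1 f ∧ p.2 e < p.2 f) :=
      fun h => mem_Av.1 hp e f h.1 h.2.1 h.2.2
    have h6 : ¬ (f < e ∧ p.1 f < p.1 e ∧ p.2 f < p.2 e) :=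
      fun h => mem_Av.1 hp f e h.1 h.2.1 h.2.2
    omega
  by_cases h1 : i < e ∧ p.1 e < p.1 i
  · have h2 := hR'.1 h1
    exact Or.inl ⟨h1.1, h2.1, h1.2, h2.2⟩
  by_cases h2 : e < j ∧ p.2 j < p.2 e
  · have h3 := hL'.1 h2
    exact Or.inr (Or.inl ⟨h3.1, h2.1, h3.2, h2.2⟩)
  have h3 := key i hi h1 (mt hL'.2 h2)
  have h4 := key j hj (mt hR'.2 h1) h2
  exact Or.inr (Or.inr ⟨h3.1, h4.1, h3.2, h4.2⟩)

/-- With `IsTwin.leftInv_eq`, this is the converse of `isTwin_of_inv`. -/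
theorem IsTwin.rightInv_eq {p : ThreePerm n} {i j : Fin n} (h : IsTwin p i j) (hij : i < j) :
    rightInv p.1 i = if p.1 j < p.1 i then rightInv p.1 j ∪ {j} else rightInv p.1 j := by
  ext e
  by_cases hi : e = i
  · subst hi
    split_ifs with hc <;> simp [mem_rightInv, hij.le, hij.ne]
  by_cases hj : e = j
  · subst hj
    split_ifs with hc <;> simp [mem_rightInv, hij, hc]
  have := h e hi hj
  split_ifs with hc <;>
    simp only [Finset.mem_union, mem_rightInv, Finset.mem_singleton, hj, or_false] <;> omega

theorem IsTwin.leftInv_eq {p : ThreePerm n} {i j : Fin n} (h : IsTwin p i j) (hij : i < j) :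
    leftInv p.2 j = if p.2 j < p.2 i then leftInv p.2 i ∪ {i} else leftInv p.2 i := by
  ext e
  by_cases hj : e = j
  · subst hj
    split_ifs with hc <;> simp [mem_leftInv, hij.le, hij.ne']
  by_cases hi : e = i
  · subst hi
    split_ifs with hc <;> simp [mem_leftInv, hij, hc]
  have := h e hi hj
  split_ifs with hc <;>
    simp only [Finset.mem_union, mem_leftInv, Finset.mem_singleton, hi, or_false] <;> omega

theorem IsTwin.point_left {p : ThreePerm n} {i j : Fin n} (h : IsTwin p i j) (hij : i < j) :
    point p i = (((rightInv p.1 j).card : ℤ) + (if p.1 j < p.1 i then 1 else 0),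
      ((leftInv p.2 i).card : ℤ)) := by
  rw [point, h.rightInv_eq hij]
  split_ifs
  · rw [Finset.card_union_of_disjoint (by simp [mem_rightInv])]
    simp
  · simp

theorem IsTwin.point_right {p : ThreePerm n} {i j : Fin n} (h : IsTwin p i j) (hij : i < j) :
    point p j = (((rightInv p.1 j).card : ℤ),
      ((leftInv p.2 i).card : ℤ) + (if p.2 j < p.2 i then 1 else 0)) := by
  rw [point, h.leftInv_eq hij]
  split_ifs
  · rw [Finset.card_union_of_disjoint (by simp [mem_leftInv])]
    simp
  · simp

/-- `q` arises from `p` by rearranging the values at the twins `i, j`, which remain twins and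
have the same base cell; the other indices keep their values and points. -/
structure IsRearrangement (p q : ThreePerm n) (i j : Fin n) : Prop where
  twin : IsTwin q i j
  fst : ∀ e, e ≠ i → e ≠ j → q.1 e = p.1 e
  snd : ∀ e, e ≠ i → e ≠ j → q.2 e = p.2 e
  point : ∀ e, e ≠ i → e ≠ j → point q e = point p e
  right : (rightInv q.1 j).card = (rightInv p.1 j).card
  left : (leftInv q.2 i).card = (leftInv p.2 i).card

theorem IsTwin.refl {p : ThreePerm n} {i j : Fin n} (h : IsTwin p i j) :
    IsRearrangement p p i j :=
  ⟨h, fun _ _ _ => rfl, fun _ _ _ => rfl, fun _ _ _ => rfl, rfl, rfl⟩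

theorem IsRearrangement.trans {p q r : ThreePerm n} {i j : Fin n} (h : IsRearrangement p q i j)
    (h' : IsRearrangement q r i j) : IsRearrangement p r i j :=
  ⟨h'.twin, fun e hi hj => (h'.fst e hi hj).trans (h.fst e hi hj),
    fun e hi hj => (h'.snd e hi hj).trans (h.snd e hi hj),
    fun e hi hj => (h'.point e hi hj).trans (h.point e hi hj),
    h'.right.trans h.right, h'.left.trans h.left⟩

theorem IsTwin.swap_fst {p : ThreePerm n} {i j : Fin n} (h : IsTwin p i j) (hij : i < j) :
    IsRearrangement p (p.1 * Equiv.swap i j, p.2) i j := by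
  have hi : (p.1 * Equiv.swap i j) i = p.1 j := by simp
  have hj : (p.1 * Equiv.swap i j) j = p.1 i := by simp
  have he : ∀ e, e ≠ i → e ≠ j → (p.1 * Equiv.swap i j) e = p.1 e := fun e h1 h2 => by
    simp [Equiv.swap_apply_of_ne_of_ne h1 h2]
  refine ⟨?_, he, fun _ _ _ => rfl, ?_, ?_, rfl⟩
  · intro e h1 h2
    have := h e h1 h2
    rw [hi, hj, he e h1 h2]
    tauto
  · intro e h1 h2
    suffices (rightInv (p.1 * Equiv.swap i j) e).card = (rightInv p.1 e).card by
      simp only [TriangleSolitaire.point, this]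
    rcases h e h1 h2 with h3 | h3 | h3
    · congr 1
      ext f
      rw [mem_rightInv, mem_rightInv, he e h1 h2]
      by_cases hfi : f = i
      · subst hfi
        omega
      by_cases hfj : f = j
      · subst hfj
        omega
      rw [he f hfi hfj]
    -- Only an index before both twins can count one of them as a right inversion; the swap then
    -- carries one inversion set to the other.
    · rw [← Finset.card_map (Equiv.swap i j).toEmbedding]
      congr 1
      ext f
      rw [Finset.mem_map_equiv, Equiv.symm_swap, mem_rightInv, mem_rightInv, he e h1 h2,
        Equiv.Perm.mul_apply, Equiv.swap_apply_self]
      refine and_congr_left fun _ => ?_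
      by_cases hfi : f = i
      · subst hfi
        rw [Equiv.swap_apply_left]
        omega
      by_cases hfj : f = j
      · subst hfj
        rw [Equiv.swap_apply_right]
        omega
      rw [Equiv.swap_apply_of_ne_of_ne hfi hfj]
    · congr 1
      ext f
      rw [mem_rightInv, mem_rightInv, he e h1 h2]
      by_cases hfi : f = i
      · subst hfi
        rw [hi]
        omega
      by_cases hfj : f = j
      · subst hfj
        rw [hj]
        omega
      rw [he f hfi hfj]
  · congr 1
    ext e
    rw [mem_rightInv, mem_rightInv, hj]
    by_cases h1 : e = i
    · subst h1
      omega
    by_cases h2 : e = j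
    · subst h2
      omega
    rw [he e h1 h2]
    have := h e h1 h2
    omega

theorem IsTwin.swap_snd {p : ThreePerm n} {i j : Fin n} (h : IsTwin p i j) (hij : i < j) :
    IsRearrangement p (p.1, p.2 * Equiv.swap i j) i j := by
  have hi : (p.2 * Equiv.swap i j) i = p.2 j := by simp
  have hj : (p.2 * Equiv.swap i j) j = p.2 i := by simp
  have he : ∀ e, e ≠ i → e ≠ j → (p.2 * Equiv.swap i j) e = p.2 e := fun e h1 h2 => by
    simp [Equiv.swap_apply_of_ne_of_ne h1 h2]
  refine ⟨?_, fun _ _ _ => rfl, he, ?_, rfl, ?_⟩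
  · intro e h1 h2
    have := h e h1 h2
    rw [hi, hj, he e h1 h2]
    tauto
  · intro e h1 h2
    suffices (leftInv (p.2 * Equiv.swap i j) e).card = (leftInv p.2 e).card by
      simp only [TriangleSolitaire.point, this]
    rcases h e h1 h2 with h3 | h3 | h3
    · rw [← Finset.card_map (Equiv.swap i j).toEmbedding]
      congr 1
      ext f
      rw [Finset.mem_map_equiv, Equiv.symm_swap, mem_leftInv, mem_leftInv, he e h1 h2,
        Equiv.Perm.mul_apply, Equiv.swap_apply_self]
      refine and_congr_left fun _ => ?_
      by_cases hfi : f = i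
      · subst hfi
        rw [Equiv.swap_apply_left]
        omega
      by_cases hfj : f = j
      · subst hfj
        rw [Equiv.swap_apply_right]
        omega
      rw [Equiv.swap_apply_of_ne_of_ne hfi hfj]
    · congr 1
      ext f
      rw [mem_leftInv, mem_leftInv, he e h1 h2]
      by_cases hfi : f = i
      · subst hfi
        omega
      by_cases hfj : f = j
      · subst hfj
        omega
      rw [he f hfi hfj]
    · congr 1
      ext f
      rw [mem_leftInv, mem_leftInv, he e h1 h2]
      by_cases hfi : f = i
      · subst hfi
        rw [hi]
        omega
      by_cases hfj : f = j
      · subst hfj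
        rw [hj]
        omega
      rw [he f hfi hfj]
  · congr 1
    ext e
    rw [mem_leftInv, mem_leftInv, hi]
    by_cases h1 : e = i
    · subst h1
      omega
    by_cases h2 : e = j
    · subst h2
      omega
    rw [he e h1 h2]
    have := h e h1 h2
    omega

theorem IsTwin.rearrange {p : ThreePerm n} {i j : Fin n} (h : IsTwin p i j) (hij : i < j)
    {s t : Equiv.Perm (Fin n)} (hs : s = 1 ∨ s = Equiv.swap i j)
    (ht : t = 1 ∨ t = Equiv.swap i j) : IsRearrangement p (p.1 * s, p.2 * t) i j := by
  have h1 : IsRearrangement p (p.1 * s, p.2) i j := by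
    rcases hs with rfl | rfl
    · exact h.refl
    · exact h.swap_fst hij
  refine h1.trans ?_
  rcases ht with rfl | rfl
  · exact h1.twin.refl
  · exact h1.twin.swap_snd hij

/-- The twin condition excludes forbidden pairs with exactly one twin, and pairs without twins are
unchanged. -/
theorem IsRearrangement.mem_Av {p q : ThreePerm n} {i j : Fin n} (h : IsRearrangement p q i j)
    (hp : p ∈ Av n) (hij : i < j) (hq : q.1 i < q.1 j → q.2 i < q.2 j → False) :
    q ∈ Av n := by
  rw [TriangleSolitaire.mem_Av]
  intro u v huv h1 h2
  by_cases hui : u = i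
  · subst hui
    by_cases hvj : v = j
    · subst hvj
      exact hq h1 h2
    have := h.twin v huv.ne' hvj
    omega
  by_cases huj : u = j
  · subst huj
    have := h.twin v (hij.trans huv).ne' huv.ne'
    omega
  by_cases hvi : v = i
  · subst hvi
    have := h.twin u hui huj
    omega
  by_cases hvj : v = j
  · subst hvj
    have := h.twin u hui huj
    omega
  rw [h.fst u hui huj, h.fst v hvi hvj] at h1
  rw [h.snd u hui huj, h.snd v hvi hvj] at h2
  exact TriangleSolitaire.mem_Av.1 hp u v huv h1 h2

end Moves

/-! ### Moves on permutations correspond to moves on the grid. -/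

section Lifting
variable {n : ℕ}

theorem mem_triple {x y : ℤ} {c : ℤ × ℤ} :
    c ∈ triple x y ↔ (c.1 = x ∧ c.2 = y) ∨ (c.1 = x + 1 ∧ c.2 = y) ∨ (c.1 = x ∧ c.2 = y + 1) := by
  simp [triple, Prod.ext_iff]

theorem card_triple (x y : ℤ) : (triple x y).card = 3 := by
  rw [triple, Finset.card_eq_three]
  exact ⟨_, _, _, by simp, by simp, by simp, rfl⟩

theorem mem_pair_of_triple {x y : ℤ} {A : Finset (ℤ × ℤ)} (hA : A ⊆ triple x y)
    (hc : A.card = 2) :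
    ((x, y) ∈ A ↔ ¬ ((x + 1, y) ∈ A ∧ (x, y + 1) ∈ A)) ∧
      ((x + 1, y) ∈ A ∨ (x, y + 1) ∈ A) := by
  have h1 := card_triple x y
  obtain ⟨c, hc', hcA⟩ := Finset.exists_mem_notMem_of_card_lt_card (s := A) (t := triple x y)
    (by omega)
  have h2 : A = (triple x y).erase c := by
    refine Finset.eq_of_subset_of_card_le (fun d hd => ?_) ?_
    · exact Finset.mem_erase.2 ⟨fun e => hcA (e ▸ hd), hA hd⟩
    · rw [Finset.card_erase_of_mem hc']
      omega
  rw [triple] at hc'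
  simp only [Finset.mem_insert, Finset.mem_singleton] at hc'
  rcases hc' with rfl | rfl | rfl <;> subst h2 <;> simp [triple]

theorem eq_of_pair_of_triple {x y : ℤ} {A B : Finset (ℤ × ℤ)} (hA : A ⊆ triple x y)
    (hA' : A.card = 2) (hB : B ⊆ triple x y) (hB' : B.card = 2)
    (h1 : (x + 1, y) ∈ A ↔ (x + 1, y) ∈ B) (h2 : (x, y + 1) ∈ A ↔ (x, y + 1) ∈ B) : A = B := by
  have h3 := (mem_pair_of_triple hA hA').1
  have h4 := (mem_pair_of_triple hB hB').1
  have key : ∀ c ∈ triple x y, c ∈ A ↔ c ∈ B := by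
    intro c hc
    rw [triple] at hc
    simp only [Finset.mem_insert, Finset.mem_singleton] at hc
    rcases hc with rfl | rfl | rfl
    · rw [h3, h4, h1, h2]
    · exact h1
    · exact h2
  ext c
  exact ⟨fun hc => (key c (hA hc)).1 hc, fun hc => (key c (hB hc)).2 hc⟩

theorem gridMove_of_sdiff_eq {P Q : Finset (ℤ × ℤ)} {x y : ℤ} (hP : (P ∩ triple x y).card = 2)
    (hQ : (Q ∩ triple x y).card = 2) (h : P \ triple x y = Q \ triple x y) (hne : P ≠ Q) :
    GridMove P Q := by
  have hout : ∀ c, c ∉ triple x y → (c ∈ P ↔ c ∈ Q) := by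
    intro c hc
    have := congrArg (c ∈ ·) h
    simpa [hc] using this
  refine ⟨x, y, hP, hQ, fun c hc => ?_, ?_⟩
  · by_contra hcT
    have := hout c hcT
    rw [Finset.mem_symmDiff] at hc
    tauto
  · have h1 : symmDiff P Q =
        (P ∩ triple x y ∪ Q ∩ triple x y) \ ((P ∩ triple x y) ∩ (Q ∩ triple x y)) := by
      ext c
      have := hout c
      simp only [Finset.mem_symmDiff, Finset.mem_sdiff, Finset.mem_union, Finset.mem_inter]
      tauto
    -- Two distinct 2-subsets of a 3-set have a union of size 3 and an intersection of size 1.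
    have h2 := Finset.card_union_add_card_inter (P ∩ triple x y) (Q ∩ triple x y)
    have h3 : (P ∩ triple x y ∪ Q ∩ triple x y).card ≤ 3 := by
      rw [← card_triple x y]
      exact Finset.card_le_card (Finset.union_subset Finset.inter_subset_right
        Finset.inter_subset_right)
    have h4 : (P ∩ triple x y ∪ Q ∩ triple x y).card ≠ 2 := by
      intro h5
      have h6 := Finset.eq_of_subset_of_card_le (Finset.subset_union_left
        (s₁ := P ∩ triple x y) (s₂ := Q ∩ triple x y)) (by omega)
      have h7 := Finset.eq_of_subset_of_card_le (Finset.subset_union_right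
        (s₁ := P ∩ triple x y) (s₂ := Q ∩ triple x y)) (by omega)
      apply hne
      rw [← Finset.sdiff_union_inter P (triple x y), ← Finset.sdiff_union_inter Q (triple x y),
        h, h6.trans h7.symm]
    have h5 := Finset.card_le_card (Finset.subset_union_left
        (s₁ := P ∩ triple x y) (s₂ := Q ∩ triple x y))
    rw [h1, Finset.card_sdiff_of_subset
      (Finset.inter_subset_left.trans Finset.subset_union_left)]
    omega

/-- The triple containing the points of the twins `i < j`. -/
def twinTriple (p : ThreePerm n) (i j : Fin n) : Finset (ℤ × ℤ) :=
  triple ((rightInv p.1 j).card : ℤ) ((leftInv p.2 i).card : ℤ)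

theorem IsTwin.mem_twinTriple {p : ThreePerm n} {i j : Fin n} (h : IsTwin p i j) (hij : i < j) :
    point p i ∈ twinTriple p i j ∧ point p j ∈ twinTriple p i j := by
  rw [twinTriple, mem_triple, mem_triple, h.point_left hij, h.point_right hij]
  simp only
  constructor <;> split_ifs <;> simp

theorem eq_or_eq_of_mem_triple {p : ThreePerm n} (hp : p ∈ Av n) {x y : ℤ} {i j e : Fin n}
    (hij : i ≠ j) (hi : point p i ∈ triple x y) (hj : point p j ∈ triple x y)
    (he : point p e ∈ triple x y) : e = i ∨ e = j := by
  by_contra! hcon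
  have := card_points_le hp x y 2 (S := {e, i, j}) (by
    rw [mem_triple] at hi hj he
    intro f hf
    simp only [Finset.mem_insert, Finset.mem_singleton] at hf
    rcases hf with rfl | rfl | rfl <;> push_cast <;> omega)
  rw [Finset.card_eq_three.2 ⟨e, i, j, hcon.1, hcon.2, hij, rfl⟩] at this
  omega

theorem Gamma_inter_triple {p : ThreePerm n} (hp : p ∈ Av n) {x y : ℤ} {i j : Fin n}
    (hij : i ≠ j) (hi : point p i ∈ triple x y) (hj : point p j ∈ triple x y) :
    Gamma p ∩ triple x y = {point p i, point p j} := by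
  ext c
  simp only [Finset.mem_inter, mem_Gamma, Finset.mem_insert, Finset.mem_singleton]
  constructor
  · rintro ⟨⟨e, rfl⟩, he⟩
    rcases eq_or_eq_of_mem_triple hp hij hi hj he with rfl | rfl <;> simp
  · rintro (rfl | rfl)
    · exact ⟨⟨i, rfl⟩, hi⟩
    · exact ⟨⟨j, rfl⟩, hj⟩

theorem card_Gamma_inter_triple {p : ThreePerm n} (hp : p ∈ Av n) {x y : ℤ} {i j : Fin n}
    (hij : i ≠ j) (hi : point p i ∈ triple x y) (hj : point p j ∈ triple x y) :
    (Gamma p ∩ triple x y).card = 2 := by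
  rw [Gamma_inter_triple hp hij hi hj, Finset.card_pair ((point_injective hp).ne hij)]

theorem mem_Gamma_sdiff_triple {p : ThreePerm n} (hp : p ∈ Av n) {x y : ℤ} {i j : Fin n}
    (hij : i ≠ j) (hi : point p i ∈ triple x y) (hj : point p j ∈ triple x y) {c : ℤ × ℤ} :
    c ∈ Gamma p \ triple x y ↔ ∃ e, e ≠ i ∧ e ≠ j ∧ point p e = c := by
  rw [Finset.mem_sdiff, mem_Gamma]
  constructor
  · rintro ⟨⟨e, rfl⟩, he⟩
    refine ⟨e, ?_, ?_, rfl⟩ <;> rintro rfl <;> contradiction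
  · rintro ⟨e, h1, h2, rfl⟩
    exact ⟨⟨e, rfl⟩, fun he => (eq_or_eq_of_mem_triple hp hij hi hj he).elim h1 h2⟩

/-- The two non-base cells record whether `σ` and `τ` invert the twins, so the occupied cells and
the arrangement of the twins determine each other. -/
theorem IsTwin.mem_Gamma_iff {p : ThreePerm n} (hp : p ∈ Av n) {i j : Fin n} (h : IsTwin p i j)
    (hij : i < j) :
    ((((rightInv p.1 j).card : ℤ) + 1, ((leftInv p.2 i).card : ℤ)) ∈ Gamma p ↔ p.1 j < p.1 i) ∧
    ((((rightInv p.1 j).card : ℤ), ((leftInv p.2 i).card : ℤ) + 1) ∈ Gamma p ↔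
      p.2 j < p.2 i) := by
  obtain ⟨hi, hj⟩ := h.mem_twinTriple hij
  have h1 := Gamma_inter_triple hp hij.ne hi hj
  have h2 : ∀ c ∈ twinTriple p i j, c ∈ Gamma p ↔ c = point p i ∨ c = point p j := by
    intro c hc
    have := congrArg (c ∈ ·) h1
    rw [twinTriple] at hc
    simpa [hc] using this
  rw [h2 _ (by simp [twinTriple, triple]), h2 _ (by simp [twinTriple, triple]),
    h.point_left hij, h.point_right hij]
  constructor <;> split_ifs <;> simp_all

theorem IsRearrangement.twinTriple_eq {p q : ThreePerm n} {i j : Fin n}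
    (h : IsRearrangement p q i j) : twinTriple q i j = twinTriple p i j := by
  rw [twinTriple, twinTriple, h.left, h.right]

theorem IsRearrangement.Gamma_sdiff {p q : ThreePerm n} {i j : Fin n}
    (h : IsRearrangement p q i j) (hp : p ∈ Av n) (hq : q ∈ Av n) (ht : IsTwin p i j)
    (hij : i < j) : Gamma q \ twinTriple p i j = Gamma p \ twinTriple p i j := by
  obtain ⟨hi, hj⟩ := ht.mem_twinTriple hij
  obtain ⟨hi', hj'⟩ := h.twin.mem_twinTriple hij
  rw [h.twinTriple_eq] at hi' hj'
  ext c
  rw [twinTriple] at *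
  rw [mem_Gamma_sdiff_triple hp hij.ne hi hj, mem_Gamma_sdiff_triple hq hij.ne hi' hj']
  refine exists_congr fun e => and_congr_right fun h1 => and_congr_right fun h2 => ?_
  rw [h.point e h1 h2]

theorem permMove_iff {p q : ThreePerm n} : PermMove p q ↔ p ∈ Av n ∧ q ∈ Av n ∧
    ∃ i j, i < j ∧ IsTwin p i j ∧ ∃ s t : Equiv.Perm (Fin n), (s = 1 ∨ s = Equiv.swap i j) ∧
      (t = 1 ∨ t = Equiv.swap i j) ∧ ¬ (s = 1 ∧ t = 1) ∧ q = (p.1 * s, p.2 * t) := by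
  refine and_congr_right fun hp => and_congr_right fun hq => exists_congr fun i =>
    exists_congr fun j => and_congr_right fun hij => ?_
  have hsw : Equiv.swap i j ≠ 1 := Equiv.swap_eq_one_iff.not.2 hij.ne
  constructor
  · rintro ⟨hR, hL, hq'⟩
    refine ⟨isTwin_of_inv hp hR hL, ?_⟩
    rcases hq' with rfl | rfl | rfl
    · exact ⟨Equiv.swap i j, 1, by simp, by simp, by simp [hsw], by simp⟩
    · exact ⟨1, Equiv.swap i j, by simp, by simp, by simp [hsw], by simp⟩
    · exact ⟨Equiv.swap i j, Equiv.swap i j, by simp, by simp, by simp [hsw], rfl⟩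
  · rintro ⟨h, s, t, hs, ht, hst, rfl⟩
    refine ⟨?_, ?_, ?_⟩
    · rw [h.rightInv_eq hij]
      split_ifs <;> simp
    · rw [h.leftInv_eq hij]
      split_ifs <;> simp
    · rcases hs with rfl | rfl <;> rcases ht with rfl | rfl <;> simp_all

theorem PermMove.symm {p q : ThreePerm n} (h : PermMove p q) : PermMove q p := by
  rw [permMove_iff] at h ⊢
  obtain ⟨hp, hq, i, j, hij, ht, s, t, hs, ht', hst, rfl⟩ := h
  refine ⟨hq, hp, i, j, hij, (ht.rearrange hij hs ht').twin, s, t, hs, ht', hst, ?_⟩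
  have h1 : ∀ s : Equiv.Perm (Fin n), s = 1 ∨ s = Equiv.swap i j → s * s = 1 := by
    rintro s (rfl | rfl) <;> simp
  simp [mul_assoc, h1 s hs, h1 t ht']

theorem mul_swap_lt_iff (σ : Equiv.Perm (Fin n)) {i j : Fin n} (hij : i ≠ j) :
    (σ * Equiv.swap i j) j < (σ * Equiv.swap i j) i ↔ ¬ σ j < σ i := by
  have := σ.injective.ne hij
  simp only [Equiv.Perm.mul_apply, Equiv.swap_apply_left, Equiv.swap_apply_right]
  omega

theorem PermMove.gridMove {p q : ThreePerm n} (h : PermMove p q) :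
    GridMove (Gamma p) (Gamma q) := by
  obtain ⟨hp, hq, i, j, hij, ht, s, t, hs, ht', hst, rfl⟩ := permMove_iff.1 h
  have hr := ht.rearrange hij hs ht'
  obtain ⟨hi, hj⟩ := ht.mem_twinTriple hij
  obtain ⟨hi', hj'⟩ := hr.twin.mem_twinTriple hij
  rw [hr.twinTriple_eq] at hi' hj'
  refine gridMove_of_sdiff_eq (card_Gamma_inter_triple hp hij.ne hi hj)
    (card_Gamma_inter_triple hq hij.ne hi' hj') (hr.Gamma_sdiff hp hq ht hij).symm ?_
  intro hG
  have h1 := ht.mem_Gamma_iff hp hij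
  have h2 := hr.twin.mem_Gamma_iff hq hij
  rw [hr.left, hr.right, ← hG, h1.1, h1.2] at h2
  have h3 := mul_swap_lt_iff p.1 hij.ne
  have h4 := mul_swap_lt_iff p.2 hij.ne
  rcases hs with rfl | rfl
  · rcases ht' with rfl | rfl
    · exact hst ⟨rfl, rfl⟩
    · exact iff_not_self (h2.2.trans h4)
  · exact iff_not_self (h2.1.trans h3)

/-- A triple is a triangle of size 2; holding two points it is tight, and `IsTight.mem_cores`
becomes the twin condition. -/
theorem isTwin_of_mem_triple {p : ThreePerm n} (hp : p ∈ Av n) {x y : ℤ} {i j : Fin n}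
    (hij : i < j) (hi : point p i ∈ triple x y) (hj : point p j ∈ triple x y) :
    IsTwin p i j ∧ ((rightInv p.1 j).card : ℤ) = x ∧ ((leftInv p.2 i).card : ℤ) = y := by
  have hs := isSys_of_mem_Av hp
  have hR : region posRank (permRank p.2) (permRank p.1) x y (n - 2 - x - y) = {i, j} := by
    have hsub : {i, j} ⊆ region posRank (permRank p.2) (permRank p.1) x y (n - 2 - x - y) := by
      rw [← card_filter_point hp]
      rw [mem_triple] at hi hj
      intro e he
      simp only [Finset.mem_insert, Finset.mem_singleton] at he
      rw [Finset.mem_filter]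
      rcases he with rfl | rfl <;> exact ⟨Finset.mem_univ _, by omega⟩
    refine (Finset.eq_of_subset_of_card_le hsub ?_).symm
    have := hs.card_region_le (Finset.Nonempty.mono hsub ⟨i, by simp⟩)
    rw [Finset.card_pair hij.ne]
    omega
  have hT := isTight_region (a := posRank) (b := permRank p.2) (c := permRank p.1) (α := x)
    (β := y) (γ := n - 2 - x - y) (by rw [hR]; exact ⟨i, by simp⟩)
    (by rw [hR, Finset.card_pair hij.ne]; push_cast; ring)
  rw [hR] at hT
  have htw : IsTwin p i j := by
    intro e h1 h2
    have := hT.mem_cores hs (e := e) (by simp [h1, h2])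
    simp only [mem_core, Finset.mem_insert, Finset.mem_singleton, forall_eq_or_imp,
      forall_eq, posRank, permRank, Fin.val_fin_lt] at this
    tauto
  refine ⟨htw, ?_⟩
  have h1 := htw.point_left hij
  have h2 := htw.point_right hij
  rw [h1, mem_triple] at hi
  rw [h2, mem_triple] at hj
  have h3 : ¬ (p.1 i < p.1 j ∧ p.2 i < p.2 j) := fun h => mem_Av.1 hp i j hij h.1 h.2
  have h4 := p.1.injective.ne hij.ne
  have h5 := p.2.injective.ne hij.ne
  split_ifs at hi hj <;> simp only at hi hj <;> omega

theorem exists_mul_lt_iff (σ : Equiv.Perm (Fin n)) {i j : Fin n} (hij : i ≠ j) (d : Prop) :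
    ∃ s : Equiv.Perm (Fin n), (s = 1 ∨ s = Equiv.swap i j) ∧ ((σ * s) j < (σ * s) i ↔ d) := by
  by_cases h : σ j < σ i ↔ d
  · exact ⟨1, Or.inl rfl, by simpa using h⟩
  · refine ⟨Equiv.swap i j, Or.inr rfl, ?_⟩
    rw [mul_swap_lt_iff σ hij]
    tauto

theorem exists_lt_of_card_Gamma_inter {p : ThreePerm n} {x y : ℤ}
    (h : (Gamma p ∩ triple x y).card = 2) :
    ∃ i j, i < j ∧ point p i ∈ triple x y ∧ point p j ∈ triple x y := by
  obtain ⟨c, d, hcd, h'⟩ := Finset.card_eq_two.1 h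
  have hc : c ∈ Gamma p ∩ triple x y := by simp [h']
  have hd : d ∈ Gamma p ∩ triple x y := by simp [h']
  rw [Finset.mem_inter, mem_Gamma] at hc hd
  obtain ⟨⟨i, rfl⟩, hi⟩ := hc
  obtain ⟨⟨j, rfl⟩, hj⟩ := hd
  have hne : i ≠ j := fun e => hcd (e ▸ rfl)
  rcases lt_or_gt_of_ne hne with hij | hij
  · exact ⟨i, j, hij, hi, hj⟩
  · exact ⟨j, i, hij, hj, hi⟩

theorem GridMove.exists_permMove {p : ThreePerm n} (hp : p ∈ Av n) {Q : Finset (ℤ × ℤ)}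
    (h : GridMove (Gamma p) Q) : ∃ q, PermMove p q ∧ Gamma q = Q := by
  obtain ⟨x, y, hP, hQ, hsub, hcard⟩ := h
  obtain ⟨i, j, hij, hi, hj⟩ := exists_lt_of_card_Gamma_inter hP
  obtain ⟨htw, hx, hy⟩ := isTwin_of_mem_triple hp hij hi hj
  -- Choose the relative orders of the twins so that they prescribe the cells occupied in `Q`.
  obtain ⟨s, hs, hs'⟩ := exists_mul_lt_iff p.1 hij.ne ((x + 1, y) ∈ Q)
  obtain ⟨t, ht, ht'⟩ := exists_mul_lt_iff p.2 hij.ne ((x, y + 1) ∈ Q)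
  have hr := htw.rearrange hij hs ht
  have hB := mem_pair_of_triple Finset.inter_subset_right hQ
  have hq : (p.1 * s, p.2 * t) ∈ Av n := by
    refine hr.mem_Av hp hij fun h1 h2 => ?_
    simp only at h1 h2
    -- Two of three cells always include a non-base one, so the twins are inverted by `σ` or by `τ`.
    rcases hB.2 with h3 | h3
    · exact absurd (hs'.2 (Finset.mem_inter.1 h3).1) h1.not_gt
    · exact absurd (ht'.2 (Finset.mem_inter.1 h3).1) h2.not_gt
  have htr : twinTriple p i j = triple x y := by rw [twinTriple, hx, hy]
  obtain ⟨hi', hj'⟩ := hr.twin.mem_twinTriple hij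
  rw [hr.twinTriple_eq, htr] at hi' hj'
  have hout := hr.Gamma_sdiff hp hq htw hij
  rw [htr] at hout
  have hG : Gamma (p.1 * s, p.2 * t) = Q := by
    have hmem := hr.twin.mem_Gamma_iff hq hij
    rw [hr.left, hr.right, hx, hy] at hmem
    have h1 : Gamma (p.1 * s, p.2 * t) ∩ triple x y = Q ∩ triple x y := by
      refine eq_of_pair_of_triple Finset.inter_subset_right
        (card_Gamma_inter_triple hq hij.ne hi' hj') Finset.inter_subset_right hQ ?_ ?_
      · rw [Finset.mem_inter, Finset.mem_inter, hmem.1, ← hs']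
      · rw [Finset.mem_inter, Finset.mem_inter, hmem.2, ← ht']
    have h2 : Gamma p \ triple x y = Q \ triple x y := by
      ext c
      rw [Finset.mem_sdiff, Finset.mem_sdiff]
      refine and_congr_left fun hc => ?_
      have := mt (@hsub c) hc
      rw [Finset.mem_symmDiff] at this
      exact ⟨fun h => by_contra fun h' => this (Or.inl ⟨h, h'⟩),
        fun h => by_contra fun h' => this (Or.inr ⟨h, h'⟩)⟩
    rw [← Finset.sdiff_union_inter Q (triple x y), ← h1, ← h2, ← hout,
      Finset.sdiff_union_inter]
  refine ⟨_, permMove_iff.2 ⟨hp, hq, i, j, hij, htw, s, t, hs, ht, ?_, rfl⟩, hG⟩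
  rintro ⟨rfl, rfl⟩
  rw [← hG] at hcard
  simp at hcard

end Lifting

/-! ### Injectivity on an orbit. -/

section Injectivity
variable {n : ℕ}

theorem mem_Av_of_reachable {p q : ThreePerm n} (hp : p ∈ Av n)
    (h : Relation.ReflTransGen PermMove p q) : q ∈ Av n := by
  rcases Relation.ReflTransGen.cases_tail h with rfl | ⟨r, -, hr⟩
  · exact hp
  · exact hr.2.1

theorem reachable_symm {p q : ThreePerm n} (h : Relation.ReflTransGen PermMove p q) :
    Relation.ReflTransGen PermMove q p := by
  induction h with
  | refl => exact .refl
  | tail _ hm ih => exact .head hm.symm ih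

theorem exists_reachable_of_grid {p : ThreePerm n} (hp : p ∈ Av n) {Q : Finset (ℤ × ℤ)}
    (h : Relation.ReflTransGen GridMove (Gamma p) Q) : ∃ q ∈ permOrbit p, Gamma q = Q := by
  induction h with
  | refl => exact ⟨p, .refl, rfl⟩
  | tail _ hm ih =>
    obtain ⟨q, hq, rfl⟩ := ih
    obtain ⟨r, hr, hr'⟩ := hm.exists_permMove (mem_Av_of_reachable hp hq)
    exact ⟨r, .tail hq hr, hr'⟩

theorem grid_reachable {p q : ThreePerm n} (h : Relation.ReflTransGen PermMove p q) :
    Relation.ReflTransGen GridMove (Gamma p) (Gamma q) :=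
  h.lift Gamma fun _ _ => PermMove.gridMove

theorem card_inv_comp (a b : Fin n → ℕ) (ψ : Equiv.Perm (Fin n)) (i : Fin n) :
    (inv (a ∘ ψ) (b ∘ ψ) i).card = (inv a b (ψ i)).card := by
  rw [← Finset.card_map ψ.toEmbedding]
  congr 1
  ext j
  simp [mem_inv, Finset.mem_map_equiv]

/-- `ψ` matches the indices of `p` and `q` having the same point. -/
def Matches (p q : ThreePerm n) (ψ : Equiv.Perm (Fin n)) : Prop :=
  ∀ i, point q (ψ i) = point p i

theorem exists_matches {p q : ThreePerm n} (hp : p ∈ Av n) (h : Gamma p = Gamma q) :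
    ∃ ψ, Matches p q ψ := by
  have h1 : ∀ i, ∃ j, point q j = point p i := fun i => by
    rw [← mem_Gamma, ← h, mem_Gamma]
    exact ⟨i, rfl⟩
  choose f hf using h1
  have hinj : f.Injective := fun i j hij => point_injective hp (by rw [← hf, ← hf, hij])
  exact ⟨Equiv.ofBijective f (Finite.injective_iff_bijective.1 hinj), hf⟩

theorem Matches.isPair {p q : ThreePerm n} {ψ : Equiv.Perm (Fin n)} (h : Matches p q ψ)
    (hp : p ∈ Av n) (hq : q ∈ Av n) :
    IsPair posRank (permRank p.2) (permRank p.1)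
      (posRank ∘ ψ) (permRank q.2 ∘ ψ) (permRank q.1 ∘ ψ) := by
  have hs := isSys_of_mem_Av hp
  have hs' := isSys_of_mem_Av hq
  have hs'' : IsSys (posRank ∘ ψ) (permRank q.2 ∘ ψ) (permRank q.1 ∘ ψ) :=
    ⟨hs'.inj_a.comp ψ.injective, hs'.inj_b.comp ψ.injective, hs'.inj_c.comp ψ.injective,
      fun i j => hs'.avoid (ψ i) (ψ j)⟩
  have h1 : ∀ i, (inv posRank (permRank q.1) (ψ i)).card =
      (inv posRank (permRank p.1) i).card := fun i => by
    have := congrArg Prod.fst (h i)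
    simpa only [point, rightInv_eq_inv, Nat.cast_inj] using this
  have h2 : ∀ i, (inv (permRank q.2) posRank (ψ i)).card =
      (inv (permRank p.2) posRank i).card := fun i => by
    have := congrArg Prod.snd (h i)
    simpa only [point, leftInv_eq_inv, Nat.cast_inj] using this
  refine ⟨hs, hs'', fun i => ?_, fun i => ?_, fun i => ?_⟩ <;> rw [card_inv_comp]
  · exact h1 i
  · exact h2 i
  · have h3 := hs.card_inv_add i
    have h4 := hs'.card_inv_add (ψ i)
    have := h1 i
    have := h2 i
    omega

/-- The cells `c, d` lie in a common full triangle on which `p` and `q`, matched by `ψ`, induce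
the same orders. -/
def Linked (p q : ThreePerm n) (ψ : Equiv.Perm (Fin n)) (c d : ℤ × ℤ) : Prop :=
  ∃ α β γ : ℤ, Good posRank (permRank p.2) (permRank p.1)
    (posRank ∘ ψ) (permRank q.2 ∘ ψ) (permRank q.1 ∘ ψ) α β γ ∧
    (α ≤ c.1 ∧ β ≤ c.2 ∧ c.1 + c.2 < n - γ) ∧ (α ≤ d.1 ∧ β ≤ d.2 ∧ d.1 + d.2 < n - γ)

theorem Linked.symm {p q : ThreePerm n} {ψ : Equiv.Perm (Fin n)} {c d : ℤ × ℤ}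
    (h : Linked p q ψ c d) : Linked p q ψ d c := by
  obtain ⟨α, β, γ, hg, hc, hd⟩ := h
  exact ⟨α, β, γ, hg, hd, hc⟩

/-- The shared cell `d` makes the two triangles overlap, so they merge. -/
theorem Linked.trans {p q : ThreePerm n} {ψ : Equiv.Perm (Fin n)} (hψ : Matches p q ψ)
    (hp : p ∈ Av n) (hq : q ∈ Av n) {c d e : ℤ × ℤ}
    (h : Linked p q ψ c d) (h' : Linked p q ψ d e) : Linked p q ψ c e := by
  obtain ⟨α, β, γ, hg, hc, hd⟩ := h
  obtain ⟨α', β', γ', hg', hd', he⟩ := h'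
  exact ⟨_, _, _, hg.merge (hψ.isPair hp hq) hg' (by omega), by omega, by omega⟩

/-- Triangles through two different cells of a triple may be disjoint, but they are close enough to
merge, and the merged triangle contains the whole triple. -/
theorem Linked.of_triple {p q : ThreePerm n} {ψ : Equiv.Perm (Fin n)} (hψ : Matches p q ψ)
    (hp : p ∈ Av n) (hq : q ∈ Av n) {x y : ℤ} {c d u v : ℤ × ℤ} (hcd : c ≠ d)
    (hc : c ∈ triple x y) (hd : d ∈ triple x y) (hu : u ∈ triple x y) (hv : v ∈ triple x y)
    (h : Linked p q ψ c c) (h' : Linked p q ψ d d) : Linked p q ψ u v := by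
  obtain ⟨α, β, γ, hg, hc', -⟩ := h
  obtain ⟨α', β', γ', hg', hd', -⟩ := h'
  rw [mem_triple] at hc hd hu hv
  have hcd' : ¬ (c.1 = d.1 ∧ c.2 = d.2) := fun h => hcd (Prod.ext h.1 h.2)
  have h1 : max α α' ≤ x + 1 ∧ max β β' ≤ y + 1 := by omega
  have h2 : max α α' + max β β' + max γ γ' ≤ n := by
    rcases hc with hc | hc | hc <;> rcases hd with hd | hd | hd <;> omega
  have h3 : min α α' ≤ x ∧ min β β' ≤ y ∧ x + y + 1 < n - min γ γ' := by
    rcases hc with hc | hc | hc <;> rcases hd with hd | hd | hd <;> omega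
  exact ⟨_, _, _, hg.merge (hψ.isPair hp hq) hg' h2, by omega, by omega⟩

theorem mem_region_iff {p : ThreePerm n} (hp : p ∈ Av n) {α β γ : ℤ} {i : Fin n} :
    i ∈ region posRank (permRank p.2) (permRank p.1) α β γ ↔
      α ≤ (point p i).1 ∧ β ≤ (point p i).2 ∧ (point p i).1 + (point p i).2 < n - γ := by
  rw [← card_filter_point hp, Finset.mem_filter, and_iff_right (Finset.mem_univ _)]

theorem linked_point {p : ThreePerm n} (q : ThreePerm n) (ψ : Equiv.Perm (Fin n))
    (hp : p ∈ Av n) (i : Fin n) : Linked p q ψ (point p i) (point p i) := by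
  have hR : region posRank (permRank p.2) (permRank p.1) (point p i).1 (point p i).2
      (n - 1 - (point p i).1 - (point p i).2) = {i} := by
    ext j
    rw [mem_region_iff hp, Finset.mem_singleton]
    constructor
    · intro h
      exact point_injective hp (Prod.ext (by omega) (by omega))
    · rintro rfl
      omega
  have hso : ∀ f g : Fin n → ℕ, SameOrder f g {i} := fun f g => by simp [SameOrder]
  refine ⟨(point p i).1, (point p i).2, n - 1 - (point p i).1 - (point p i).2,
    ⟨?_, ?_, ?_, ?_, ?_⟩, by omega, by omega⟩ <;> rw [hR]
  · simp
  · simp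
  all_goals exact hso _ _

/-- A move only redistributes positions and values between the twins, whose old and new points share
one triple. -/
theorem linked_of_permMove {p q r r' : ThreePerm n} {ψ : Equiv.Perm (Fin n)}
    (hψ : Matches p q ψ) (hp : p ∈ Av n) (hq : q ∈ Av n) (hm : PermMove r r')
    (h : ∀ i, Linked p q ψ (point r i) (point r i)) :
    (∀ i, Linked p q ψ (point r' i) (point r i)) ∧
    (∀ v, Linked p q ψ (point r' (r'.1.symm v)) (point r (r.1.symm v))) ∧
    (∀ v, Linked p q ψ (point r' (r'.2.symm v)) (point r (r.2.symm v))) := by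
  obtain ⟨hr, -, i, j, hij, htw, s, t, hs, ht, -, rfl⟩ := permMove_iff.1 hm
  have hra := htw.rearrange hij hs ht
  generalize (r.1 * s, r.2 * t) = r' at hra
  obtain ⟨hi, hj⟩ := htw.mem_twinTriple hij
  obtain ⟨hi', hj'⟩ := hra.twin.mem_twinTriple hij
  rw [hra.twinTriple_eq] at hi' hj'
  have hin : ∀ e e', (e = i ∨ e = j) → (e' = i ∨ e' = j) →
      Linked p q ψ (point r' e) (point r e') := by
    intro e e' he he'
    refine Linked.of_triple hψ hp hq ((point_injective hr).ne hij.ne) hi hj ?_ ?_ (h i) (h j)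
    · rcases he with rfl | rfl <;> assumption
    · rcases he' with rfl | rfl <;> assumption
  have hsame : ∀ e, Linked p q ψ (point r' e) (point r e) := by
    intro e
    by_cases he : e = i ∨ e = j
    · exact hin e e he he
    · rw [not_or] at he
      rw [hra.point e he.1 he.2]
      exact h e
  have hval : ∀ f f' : Equiv.Perm (Fin n), (∀ e, e ≠ i → e ≠ j → f' e = f e) → ∀ v,
      Linked p q ψ (point r' (f'.symm v)) (point r (f.symm v)) := by
    intro f f' hf v
    by_cases he : f.symm v = i ∨ f.symm v = j
    · by_cases he' : f'.symm v = i ∨ f'.symm v = j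
      · exact hin _ _ he' he
      · rw [not_or] at he'
        have := hf _ he'.1 he'.2
        rw [Equiv.apply_symm_apply, ← Equiv.symm_apply_eq] at this
        rw [this]
        exact hsame _
    · rw [not_or] at he
      have := hf _ he.1 he.2
      rw [Equiv.apply_symm_apply, ← Equiv.eq_symm_apply] at this
      rw [← this]
      exact hsame _
  exact ⟨hsame, hval _ _ hra.fst, hval _ _ hra.snd⟩

theorem linked_of_reachable {p q r : ThreePerm n} {ψ : Equiv.Perm (Fin n)}
    (hψ : Matches p q ψ) (hp : p ∈ Av n) (hq : q ∈ Av n)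
    (hr : Relation.ReflTransGen PermMove p r) :
    (∀ i, Linked p q ψ (point r i) (point p i)) ∧
    (∀ v, Linked p q ψ (point r (r.1.symm v)) (point p (p.1.symm v))) ∧
    (∀ v, Linked p q ψ (point r (r.2.symm v)) (point p (p.2.symm v))) := by
  induction hr with
  | refl => exact ⟨fun _ => linked_point q ψ hp _, fun _ => linked_point q ψ hp _,
      fun _ => linked_point q ψ hp _⟩
  | tail _ hm ih =>
    have h := linked_of_permMove hψ hp hq hm fun i => (ih.1 i).trans hψ hp hq (ih.1 i).symm
    exact ⟨fun i => (h.1 i).trans hψ hp hq (ih.1 i),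
      fun v => (h.2.1 v).trans hψ hp hq (ih.2.1 v), fun v => (h.2.2 v).trans hψ hp hq (ih.2.2 v)⟩

theorem Linked.lt_iff {p q : ThreePerm n} {ψ : Equiv.Perm (Fin n)} (hp : p ∈ Av n)
    {i j : Fin n} (h : Linked p q ψ (point p i) (point p j)) :
    (i < j ↔ ψ i < ψ j) ∧ (p.1 i < p.1 j ↔ q.1 (ψ i) < q.1 (ψ j)) ∧
      (p.2 i < p.2 j ↔ q.2 (ψ i) < q.2 (ψ j)) := by
  obtain ⟨α, β, γ, hg, hi, hj⟩ := h
  rw [← mem_region_iff hp] at hi hj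
  exact ⟨hg.same_a i hi j hj, hg.same_c i hi j hj, hg.same_b i hi j hj⟩

/-- A permutation preserving the classes of a relation and the order within each class is
trivial. -/
theorem perm_eq_one_of_rel (θ : Equiv.Perm (Fin n)) (R : Fin n → Fin n → Prop)
    (hR : ∀ i, R (θ i) i) (hlt : ∀ i j, R i j → (i < j ↔ θ i < θ j))
    (htrans : ∀ i j k, R i j → R j k → R i k) : θ = 1 := by
  by_contra hne
  have hex : (Finset.univ.filter fun i => θ i ≠ i).Nonempty := by
    by_contra h
    rw [Finset.not_nonempty_iff_eq_empty, Finset.filter_eq_empty_iff] at h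
    exact hne (Equiv.ext fun i => by simpa using h (Finset.mem_univ i))
  -- For the least moved `i`, both `θ i` and `θ.symm i` exceed `i`. Since `i` and `θ.symm i` are
  -- related, monotonicity would give `θ i < i`.
  obtain ⟨i, hi, hmin⟩ := Finset.exists_min_image _ id hex
  have hi' : θ i ≠ i := (Finset.mem_filter.1 hi).2
  have hmin' : ∀ k, θ k ≠ k → i ≤ k := fun k hk => hmin k (by simpa using hk)
  have h1 : i ≤ θ i := hmin' _ fun h => hi' (θ.injective h)
  have h2 : θ (θ.symm i) = i := θ.apply_symm_apply i
  have h3 : θ.symm i ≠ i := fun h => hi' (by rwa [h] at h2)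
  have h4 : i ≤ θ.symm i := hmin' _ (by rw [h2]; exact h3.symm)
  have h5 : R (θ i) (θ.symm i) := htrans _ _ _ (hR i) (by simpa [h2] using hR (θ.symm i))
  have h6 : R i (θ.symm i) := by simpa [h2] using hR (θ.symm i)
  have h7 := (hlt _ _ h6).1 (lt_of_le_of_ne h4 h3.symm)
  rw [h2] at h7
  exact absurd h7 h1.not_gt

/-- In terms of ranks, `g * ψ * f⁻¹` compares the order `f` on `p` with the order `g` on the matched
indices of `q`. Tracking the points shows that it preserves linked classes. -/
theorem mul_eq_of_linked {p q : ThreePerm n} {ψ : Equiv.Perm (Fin n)}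
    (hψ : Matches p q ψ) (hp : p ∈ Av n) (hq : q ∈ Av n) (f g : Equiv.Perm (Fin n))
    (h : ∀ v, Linked p q ψ (point q (g.symm v)) (point p (f.symm v)))
    (hlt : ∀ i j, Linked p q ψ (point p i) (point p j) → (f i < f j ↔ g (ψ i) < g (ψ j))) :
    g * ψ = f := by
  have key : g * ψ * f⁻¹ = 1 := by
    refine perm_eq_one_of_rel _
      (fun v w => Linked p q ψ (point p (f.symm v)) (point p (f.symm w))) (fun v => ?_)
      (fun v w hvw => ?_) fun u v w h1 h2 => h1.trans hψ hp hq h2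
    · have h1 := (h ((g * ψ * f⁻¹) v)).symm
      have h2 : g.symm ((g * ψ * f⁻¹) v) = ψ (f.symm v) := by
        rw [Equiv.symm_apply_eq]
        rfl
      rwa [h2, hψ] at h1
    · have h1 := hlt _ _ hvw
      rw [Equiv.apply_symm_apply, Equiv.apply_symm_apply] at h1
      exact h1
  exact mul_inv_eq_one.1 key

theorem eq_of_Gamma_eq_of_reachable {p q : ThreePerm n} (hp : p ∈ Av n)
    (h : Relation.ReflTransGen PermMove p q) (hG : Gamma p = Gamma q) : p = q := by
  have hq := mem_Av_of_reachable hp h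
  obtain ⟨ψ, hψ⟩ := exists_matches hp hG
  obtain ⟨h1, h2, h3⟩ := linked_of_reachable hψ hp hq h
  -- The position order forces the matching itself to be trivial; the other two orders then give
  -- equality of the values.
  have e1 : 1 * ψ = 1 := mul_eq_of_linked hψ hp hq 1 1 h1 fun i j hl => (hl.lt_iff hp).1
  have e2 := mul_eq_of_linked hψ hp hq _ _ h2 fun i j hl => (hl.lt_iff hp).2.1
  have e3 := mul_eq_of_linked hψ hp hq _ _ h3 fun i j hl => (hl.lt_iff hp).2.2
  rw [one_mul] at e1
  rw [e1, mul_one] at e2 e3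
  exact Prod.ext e2.symm e3.symm

end Injectivity
end TriangleSolitaire

theorem mainTheorem8 (n : ℕ) (O : Set (TriangleSolitaire.ThreePerm n))
    (hO : TriangleSolitaire.IsPermOrbit n O) :
    ∃ O' : Set (Finset (ℤ × ℤ)), TriangleSolitaire.IsSparseGridOrbit n O' ∧
      Set.BijOn TriangleSolitaire.Gamma O O' := by
  open TriangleSolitaire in
  obtain ⟨p, hp, rfl⟩ := hO
  refine ⟨gridOrbit n (Gamma p), ⟨⟨Gamma p, (isSparse_Gamma hp).1, rfl⟩, ?_⟩, ?_, ?_, ?_⟩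
  · rintro Q ⟨-, hQ⟩
    obtain ⟨q, hq, rfl⟩ := exists_reachable_of_grid hp hQ
    exact isSparse_Gamma (mem_Av_of_reachable hp hq)
  · intro q hq
    exact ⟨(isSparse_Gamma (mem_Av_of_reachable hp hq)).1, grid_reachable hq⟩
  · intro q hq r hr hG
    exact eq_of_Gamma_eq_of_reachable (mem_Av_of_reachable hp hq)
      ((reachable_symm hq).trans hr) hG
  · rintro Q ⟨-, hQ⟩
    exact exists_reachable_of_grid hp hQ
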